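/- Let $p$ be a prime and $c \ge 2$ an integer. Suppose that either (a) $(R,\mathfrak m)$ is a regular local ring of characteristic $p$ and $I \subseteq R$ is an ideal of height $c$; or (b) $R$ is a standard graded regular ring over a field of characteristic $p$, with homogeneous maximal ideal $\mathfrak m$, and $I \subseteq R$ is a homogeneous ideal of height $c$. Assume that $R/I$ is Gorenstein, and let $$\cdots \to R^{\beta_2} \xrightarrow{\phi_2} R^{\beta_1} \xrightarrow{\phi_1} R \to R/I \to 0$$ be a minimal (in case (b): minimal graded) free resolution of $R/I$, with the $\phi_i$ written as matrices. Then $\beta_c = 1$ and $\beta_i = 0$ for $i > c$. Let $I^{[p]}$ be the ideal generated by the $p$-th powers of the elements of $I$, and let $\phi_i^{[p]}$ be obtained from $\phi_i$ by raising all entries to the $p$-th power. If $\alpha_i : R^{\beta_i} \to R^{\beta_i}$ ($i \ge 0$, $\beta_0 = 1$) are any maps with $\alpha_0 = \mathrm{id}_R$ and $\phi_i \alpha_i = \alpha_{i-1} \phi_i^{[p]}$ for all $i \ge 1$, and $\alpha_c$ is multiplication by $\Delta \in R$, then $$\Delta \cdot I \subseteq \mathfrak m \cdot I^{[p]}.$$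 -/

import Mathlib

universe u v

/-- A Noetherian local ring is *Gorenstein* if it is Cohen-Macaulay and has an irreducible parameter
ideal: there is a regular sequence generating an ideal which is primary to the maximal ideal (so that
the sequence is also a system of parameters) and which is not the intersection of two strictly
larger ideals. -/
class IsGorensteinLocalRing (A : Type u) [CommRing A] : Prop extends
    IsLocalRing A, IsNoetherianRing A where
  exists_irreducible_parameter_ideal : ∃ rs : List A,
    RingTheory.Sequence.IsRegular A rs ∧
    (Ideal.ofList rs).radical = IsLocalRing.maximalIdeal A ∧
    InfIrred (Ideal.ofList rs)

/-- A Noetherian ring is *Gorenstein* if its localization at every maximal ideal is a Gorenstein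
local ring. -/
class IsGorensteinRing (A : Type u) [CommRing A] : Prop extends IsNoetherianRing A where
  isGorensteinLocalRing_localization (P : Ideal A) [P.IsMaximal] :
    IsGorensteinLocalRing (Localization.AtPrime P)

/-- A *standard graded* algebra over a field `k`: an `ℕ`-graded `k`-algebra whose component of
degree `0` is `k` and which is generated over `k` by its finite-dimensional component of
degree `1`. -/
structure IsStandardGraded {k : Type v} {R : Type u} [Field k] [CommRing R] [Algebra k R]
    (𝒜 : ℕ → Submodule k R) [GradedAlgebra 𝒜] : Prop where
  degree_zero : 𝒜 0 = (1 : Submodule k R)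
  finite_degree_one : Module.Finite k (𝒜 1)
  adjoin_degree_one : Algebra.adjoin k (𝒜 1 : Set R) = ⊤

/-- The Frobenius power `I^{[p]}`: the ideal generated by the `p`-th powers of the elements of `I`
(in characteristic `p`, the `p`-th powers of any generators of `I` suffice). -/
def frobeniusPower {R : Type u} [CommRing R] (p : ℕ) (I : Ideal R) : Ideal R :=
  Ideal.span ((fun x : R => x ^ p) '' (I : Set R))

/-- A resolution of `R ⧸ I` by finite free modules with chosen bases,
`⋯ → R ^ rank 2 → R ^ rank 1 → R → R ⧸ I → 0`,
where `d i` is the matrix of the map `R ^ rank (i + 1) → R ^ rank i` and the map `R → R ⧸ I` is the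
quotient map. -/
structure FreeResolution {R : Type u} [CommRing R] (I : Ideal R) where
  /-- The ranks of the free modules. -/
  rank : ℕ → ℕ
  /-- The matrices of the differentials. -/
  d : (i : ℕ) → Matrix (Fin (rank i)) (Fin (rank (i + 1))) R
  rank_zero : rank 0 = 1
  /-- Exactness at `R ^ rank 0 = R`: the image of the first differential is `I`. -/
  span_d_zero : Ideal.span {x : R | ∃ a b, d 0 a b = x} = I
  /-- Exactness at `R ^ rank (i + 1)`. -/
  exact : ∀ i, Function.Exact (d (i + 1)).mulVecLin (d i).mulVecLin

namespace FreeResolution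

variable {R : Type u} [CommRing R] {I : Ideal R}

/-- The resolution is *minimal* with respect to `𝔪`: every differential maps into `𝔪` times its
target, i.e. all matrix entries lie in `𝔪`. -/
def IsMinimal (F : FreeResolution I) (𝔪 : Ideal R) : Prop :=
  ∀ i a b, F.d i a b ∈ 𝔪

/-- The resolution is *graded*: the basis elements can be assigned degrees such that all
differentials are homogeneous of degree `0`. -/
def IsGraded {k : Type v} [Field k] [Algebra k R] (F : FreeResolution I)
    (𝒜 : ℕ → Submodule k R) : Prop :=
  ∃ deg : (i : ℕ) → Fin (F.rank i) → ℤ, ∀ i a b,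
    F.d i a b = 0 ∨ ∃ n : ℕ, deg (i + 1) b = deg i a + n ∧ F.d i a b ∈ 𝒜 n

/-- A comparison map from the Frobenius twist of `F` (same free modules, differentials obtained
by raising all matrix entries to the `p`-th power) to `F`, which is the identity of `R` in
degree `0` and hence lifts the natural surjection `R ⧸ I^{[p]} → R ⧸ I`. -/
structure FrobeniusComparison (p : ℕ) (F : FreeResolution I) where
  /-- The matrices of the components. -/
  map : (i : ℕ) → Matrix (Fin (F.rank i)) (Fin (F.rank i)) R
  map_zero : map 0 = 1
  comm : ∀ i, F.d i * map (i + 1) = map i * (F.d i).map (fun x => x ^ p)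

end FreeResolution

/-!
Write `φ_i` for the differentials of the minimal resolution, and let `c` be the height of `I`.

*The comparison map vanishes modulo `𝔪` in positive degrees* (`FrobeniusComparison.map_mem`). This
holds over every ring of characteristic `p`, for resolutions with entries in any ideal `𝔪`. A
resolution of `R ⧸ I` by a simplicial commutative `R`-algebra, here iterated polynomial rings
(`polyTower`), carries a Frobenius, which covers the Frobenius of `R ⧸ I`; hence it agrees with `α`
after comparison of the resolutions, up to a homotopy whose contribution vanishes modulo `𝔪`. On a
simplicial commutative ring of characteristic `p` the Frobenius kills homology in positive degrees:
`s₀ z * (s₁ z) ^ (p - 1)` bounds `z ^ p` up to sign.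

*The resolution of a Gorenstein quotient* (`BasedComplex.IsResolution.gorenstein`). In the local
case, dividing `R ⧸ I` by a regular sequence `y₁, …, y_d` generating an irreducible parameter ideal
leads to an irreducible ideal `J` primary to `𝔪`. The iterated mapping cone of the `y_k` is a
minimal resolution of `R ⧸ J`. Minimal generators of `𝔪` form a regular sequence
(`IsRegularLocalRing.isRegularSeqMod`), and reducing modulo them shows that the cone has length at
most `n = dim R` (`isEmpty_of_length_lt`), that its module in degree `n` has rank one, the dimension
of the socle of `R ⧸ J` (`card_length_eq_one`), and that its dual is exact below degree `n`
(`coexactMod_bot`). All of this descends to the resolution of `R ⧸ I` with `n - d` in place of `n`,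
and comparing heights with lengths of regular sequences gives `n - d = c`. By self-duality the
entries of `φ_c` generate `I`: multiplication by an element of `I` is null-homotopic on the
resolution, and multiplication by an entry of `φ_c` is null-homotopic on its dual, which resolves
`Ext^c(R ⧸ I, R)` (`mem_of_homotopy`).

Comparing the two sides of `φ_c * α_c = α_{c - 1} * φ_c^{[p]}` now gives the claim, since `c - 1` is
positive (`FrobeniusComparison.span_mul_le`). In the graded case the assertions on ranks and on the
entries of `φ_c` follow by localizing at the irrelevant ideal, because a homogeneous ideal is
determined by this localization (`IsStandardGraded.comap_map_localization`).
-/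

open scoped Matrix

/-! ### A simplicial resolution by polynomial rings -/

section PolynomialTower

variable (R B : Type u) [CommRing R] [CommRing B] [Algebra R B]

/-- The augmented simplicial `R`-algebra obtained by iterating the functor "polynomial ring on the
underlying set", starting from `B`. Indices are shifted by one: `polyTower R B (n + 1)` is the
term of simplicial degree `n`, and `polyTower R B 0 = B` is the augmentation. -/
noncomputable def polyTower : ℕ → CommAlgCat.{u} R
  | 0 => .of R B
  | n + 1 => .of R (MvPolynomial (polyTower n) R)

namespace polyTower

/-- The variable attached to an element of the previous level. This map of sets (not additive) is an
extra degeneracy. -/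
noncomputable def var (n : ℕ) (y : polyTower R B n) : polyTower R B (n + 1) :=
  (MvPolynomial.X y : MvPolynomial (polyTower R B n) R)

/-- The algebra homomorphism prescribed on the variables. -/
noncomputable def lift {n : ℕ} {C : Type u} [CommRing C] [Algebra R C] (f : polyTower R B n → C) :
    polyTower R B (n + 1) →ₐ[R] C :=
  (MvPolynomial.aeval f : MvPolynomial (polyTower R B n) R →ₐ[R] C)

variable {R B}

@[simp] lemma lift_var {n : ℕ} {C : Type u} [CommRing C] [Algebra R C] (f : polyTower R B n → C)
    (y : polyTower R B n) : lift R B f (var R B n y) = f y :=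
  MvPolynomial.aeval_X f y

lemma algHom_ext {n : ℕ} {C : Type u} [CommRing C] [Algebra R C]
    {f g : polyTower R B (n + 1) →ₐ[R] C} (h : ∀ y, f (var R B n y) = g (var R B n y)) : f = g :=
  MvPolynomial.algHom_ext (A := C) (σ := polyTower R B n) h

variable (R B)

/-- The face maps: `face n j` is the `j`-th face for `j ≤ n`. The zeroth face evaluates a variable,
and the `(j + 1)`-st face applies the `j`-th face to the variables. -/
noncomputable def face : (n : ℕ) → ℕ → (polyTower R B (n + 1) →ₐ[R] polyTower R B n)
  | 0, _ => lift R B id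
  | _ + 1, 0 => lift R B id
  | n + 1, j + 1 => lift R B fun y => var R B n (face n j y)

/-- The degeneracy `s₀`. -/
noncomputable def degen₀ (n : ℕ) : polyTower R B (n + 1) →ₐ[R] polyTower R B (n + 2) :=
  lift R B fun y => var R B (n + 1) (var R B n y)

/-- The degeneracy `s₁`. -/
noncomputable def degen₁ (n : ℕ) : polyTower R B (n + 2) →ₐ[R] polyTower R B (n + 3) :=
  lift R B fun y => var R B (n + 2) (degen₀ R B n y)

variable {R B}

@[simp] lemma face_zero_var (n : ℕ) (y : polyTower R B n) : face R B n 0 (var R B n y) = y := by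
  cases n <;> simp [face]

@[simp] lemma face_succ_var (n j : ℕ) (y : polyTower R B (n + 1)) :
    face R B (n + 1) (j + 1) (var R B (n + 1) y) = var R B n (face R B n j y) := by
  simp [face]

lemma face_face (n i j : ℕ) (hij : i ≤ j) (hj : j ≤ n) (y : polyTower R B (n + 2)) :
    face R B n i (face R B (n + 1) (j + 1) y) = face R B n j (face R B (n + 1) i y) := by
  suffices h : (face R B n i).comp (face R B (n + 1) (j + 1)) =
      (face R B n j).comp (face R B (n + 1) i) from DFunLike.congr_fun h y
  clear y
  induction n generalizing i j with
  | zero =>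
    obtain rfl : i = 0 := by omega
    refine algHom_ext fun z => ?_
    simp
  | succ n ih =>
    refine algHom_ext fun z => ?_
    cases i with
    | zero => simp
    | succ i =>
      obtain ⟨j, rfl⟩ : ∃ k, j = k + 1 := ⟨j - 1, by omega⟩
      simp only [AlgHom.comp_apply, face_succ_var]
      rw [← AlgHom.comp_apply, ih i j (by omega) (by omega), AlgHom.comp_apply]

lemma face_zero_degen₀ (n : ℕ) (y : polyTower R B (n + 1)) :
    face R B (n + 1) 0 (degen₀ R B n y) = y := by
  suffices h : (face R B (n + 1) 0).comp (degen₀ R B n) = AlgHom.id R _ from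
    DFunLike.congr_fun h y
  exact algHom_ext fun z => by simp [degen₀]

lemma face_one_degen₀ (n : ℕ) (y : polyTower R B (n + 1)) :
    face R B (n + 1) 1 (degen₀ R B n y) = y := by
  suffices h : (face R B (n + 1) 1).comp (degen₀ R B n) = AlgHom.id R _ from
    DFunLike.congr_fun h y
  exact algHom_ext fun z => by simp [degen₀]

lemma face_degen₀ (n j : ℕ) (y : polyTower R B (n + 2)) :
    face R B (n + 2) (j + 2) (degen₀ R B (n + 1) y) =
      degen₀ R B n (face R B (n + 1) (j + 1) y) := by
  suffices h : (face R B (n + 2) (j + 2)).comp (degen₀ R B (n + 1)) =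
    (degen₀ R B n).comp (face R B (n + 1) (j + 1)) from DFunLike.congr_fun h y
  exact algHom_ext fun z => by simp [degen₀]

lemma face_zero_degen₁ (n : ℕ) (y : polyTower R B (n + 2)) :
    face R B (n + 2) 0 (degen₁ R B n y) = degen₀ R B n (face R B (n + 1) 0 y) := by
  suffices h : (face R B (n + 2) 0).comp (degen₁ R B n) =
    (degen₀ R B n).comp (face R B (n + 1) 0) from DFunLike.congr_fun h y
  exact algHom_ext fun z => by simp [degen₁]

lemma face_one_degen₁ (n : ℕ) (y : polyTower R B (n + 2)) :
    face R B (n + 2) 1 (degen₁ R B n y) = y := by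
  suffices h : (face R B (n + 2) 1).comp (degen₁ R B n) = AlgHom.id R _ from
    DFunLike.congr_fun h y
  exact algHom_ext fun z => by simp [degen₁, face_zero_degen₀]

/-- Every element of an augmented polynomial tower all of whose faces vanish is the zeroth face of
an element whose other faces vanish. The extra degeneracy is not additive, hence the correction by
the variable attached to `0`. -/
lemma exists_face_zero_eq (n : ℕ) (z : polyTower R B n)
    (hz : ∀ m j, ∀ h : n = m + 1, j ≤ m → face R B m j (h ▸ z) = 0) :
    ∃ w : polyTower R B (n + 1), face R B n 0 w = z ∧ ∀ j, 1 ≤ j → j ≤ n → face R B n j w = 0 := by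
  refine ⟨var R B n z - var R B n 0, by simp, fun j hj hjn => ?_⟩
  obtain ⟨m, rfl⟩ : ∃ m, n = m + 1 := ⟨n - 1, by omega⟩
  obtain ⟨j, rfl⟩ : ∃ k, j = k + 1 := ⟨j - 1, by omega⟩
  rw [map_sub, face_succ_var, face_succ_var, hz m j rfl (by omega), map_zero, sub_self]

variable (R B)

/-- The alternating sum of the face maps. -/
noncomputable def boundary (n : ℕ) : polyTower R B (n + 1) →ₗ[R] polyTower R B n :=
  ∑ j ∈ Finset.range (n + 1), (-1 : R) ^ j • (face R B n j).toLinearMap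

variable {R B}

lemma boundary_apply (n : ℕ) (y : polyTower R B (n + 1)) :
    boundary R B n y = ∑ j ∈ Finset.range (n + 1), (-1 : R) ^ j • face R B n j y := by
  simp [boundary]

lemma boundary_of_face_eq_zero (n : ℕ) (y : polyTower R B (n + 1))
    (h : ∀ j, 1 ≤ j → j ≤ n → face R B n j y = 0) : boundary R B n y = face R B n 0 y := by
  rw [boundary_apply, Finset.sum_eq_single 0]
  · simp
  · intro j hj hj0
    rw [h j (by omega) (by simpa [Nat.lt_succ_iff] using hj), smul_zero]
  · simp

lemma boundary_boundary (n : ℕ) (y : polyTower R B (n + 2)) :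
    boundary R B n (boundary R B (n + 1) y) = 0 := by
  simp only [boundary_apply, map_sum, map_smul, Finset.smul_sum, smul_smul]
  rw [← Finset.sum_product']
  refine Finset.sum_involution
    (fun q _ => if q.2 < q.1 then (q.2, q.1 - 1) else (q.2 + 1, q.1)) ?_ ?_ ?_ ?_
  · rintro ⟨j, i⟩ hq
    simp only [Finset.mem_product, Finset.mem_range] at hq
    dsimp only
    split_ifs with h
    · obtain ⟨j, rfl⟩ : ∃ k, j = k + 1 := ⟨j - 1, by omega⟩
      rw [face_face n i j (by omega) (by omega)]
      simp only [Nat.add_sub_cancel]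
      rw [← add_smul]
      convert zero_smul R _
      ring
    · rw [face_face n j i (by omega) (by omega), ← add_smul]
      convert zero_smul R _
      ring
  · rintro ⟨j, i⟩ hq - h
    dsimp only at h
    split_ifs at h with h' <;> simp only [Prod.mk.injEq] at h <;> omega
  · rintro ⟨j, i⟩ hq
    simp only [Finset.mem_product, Finset.mem_range] at hq ⊢
    split_ifs <;> dsimp only <;> omega
  · rintro ⟨j, i⟩ hq
    dsimp only
    grind

end polyTower

end PolynomialTower

/-! ### The Frobenius acts as zero on positive degree homology -/

section Auxiliary

/-- Dependent recursion with an invariant `P` and a relation `Q` between consecutive terms. -/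
lemma exists_dependent_sequence {α : ℕ → Type*} (P : ∀ n, α n → Prop)
    (Q : ∀ n, α n → α (n + 1) → Prop) (x₀ : α 0) (h₀ : P 0 x₀)
    (step : ∀ n x, P n x → ∃ y, P (n + 1) y ∧ Q n x y) :
    ∃ f : ∀ n, α n, f 0 = x₀ ∧ (∀ n, P n (f n)) ∧ ∀ n, Q n (f n) (f (n + 1)) := by
  choose g hg using step
  let F : ∀ n, {x : α n // P n x} := fun n =>
    Nat.rec ⟨x₀, h₀⟩ (fun n x => ⟨g n x.1 x.2, (hg n x.1 x.2).1⟩) n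
  exact ⟨fun n => (F n).1, rfl, fun n => (F n).2, fun n => (hg n (F n).1 (F n).2).2⟩

lemma exists_lift_of_forall_mem_range {R M K N : Type*} [CommRing R] [AddCommGroup M] [Module R M]
    [AddCommGroup K] [Module R K] [AddCommGroup N] [Module R N] [Module.Projective R M]
    (g : K →ₗ[R] N) (f : M →ₗ[R] N) (h : ∀ x, ∃ v, g v = f x) :
    ∃ l : M →ₗ[R] K, ∀ x, g (l x) = f x := by
  obtain ⟨l, hl⟩ := Module.projective_lifting_property g.rangeRestrict
    (f.codRestrict (LinearMap.range g) h) g.surjective_rangeRestrict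
  exact ⟨l, fun x => congrArg Subtype.val (LinearMap.congr_fun hl x)⟩

end Auxiliary

instance polyTower.projective (R B : Type u) [CommRing R] [CommRing B] [Algebra R B] (n : ℕ) :
    Module.Projective R (polyTower R B (n + 1)) :=
  inferInstanceAs (Module.Projective R (MvPolynomial (polyTower R B n) R))

lemma polyTower.algebraMap_zero_eq_zero_iff {R : Type u} [CommRing R] {I : Ideal R} {r : R} :
    algebraMap R (polyTower R (R ⧸ I) 0) r = 0 ↔ r ∈ I :=
  Ideal.Quotient.eq_zero_iff_mem

namespace FreeResolution

variable {R : Type u} [CommRing R] {I : Ideal R} (F : FreeResolution I)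

open polyTower

lemma eq_of_fin_rank_zero (a b : Fin (F.rank 0)) : a = b := by
  have := F.rank_zero
  ext
  omega

/-- The unique basis element in degree `0`. -/
def basisZero : Fin (F.rank 0) := ⟨0, by rw [F.rank_zero]; exact Nat.one_pos⟩

lemma d_zero_mem (a : Fin (F.rank 0)) (b : Fin (F.rank 1)) : F.d 0 a b ∈ I := by
  exact F.span_d_zero.le (Ideal.subset_span ⟨a, b, rfl⟩)

lemma d_mul_d (i : ℕ) : F.d i * F.d (i + 1) = 0 := by
  apply Matrix.mulVec_injective
  funext v
  rw [← Matrix.mulVec_mulVec, Matrix.zero_mulVec]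
  exact (F.exact i (F.d (i + 1) *ᵥ v)).2 ⟨v, rfl⟩

lemma exists_mulVec_eq {i : ℕ} {v : Fin (F.rank (i + 1)) → R} (hv : F.d i *ᵥ v = 0) :
    ∃ w, F.d (i + 1) *ᵥ w = v :=
  (F.exact i v).1 hv

lemma exists_mulVec_zero_eq {v : Fin (F.rank 0) → R} (hv : v F.basisZero ∈ I) :
    ∃ w, F.d 0 *ᵥ w = v := by
  suffices h : I ≤ ((LinearMap.range (F.d 0).mulVecLin).map
      (LinearMap.proj F.basisZero : (Fin (F.rank 0) → R) →ₗ[R] R)) by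
    obtain ⟨_, ⟨w, rfl⟩, hw⟩ := h hv
    refine ⟨w, funext fun a => ?_⟩
    rw [F.eq_of_fin_rank_zero a F.basisZero]
    exact hw
  refine F.span_d_zero.ge.trans (Ideal.span_le.2 ?_)
  rintro _ ⟨a, b, rfl⟩
  refine ⟨_, ⟨Pi.single b 1, rfl⟩, ?_⟩
  rw [F.eq_of_fin_rank_zero a F.basisZero]
  simp

lemma mulVec_zero_mem (w : Fin (F.rank 1) → R) (a : Fin (F.rank 0)) : (F.d 0 *ᵥ w) a ∈ I := by
  rw [Matrix.mulVec, dotProduct]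
  exact Ideal.sum_mem _ fun _ _ => Ideal.mul_mem_right _ _ (F.d_zero_mem _ _)

/-- A chain map from the resolution to the normalized chains of the polynomial resolution. -/
lemma exists_map_polyTower : ∃ g : ∀ i, Fin (F.rank i) → polyTower R (R ⧸ I) (i + 1),
    (∀ e, face R (R ⧸ I) 0 0 (g 0 e) = 1) ∧
    (∀ i e j, 1 ≤ j → j ≤ i → face R (R ⧸ I) i j (g i e) = 0) ∧
    ∀ i e, face R (R ⧸ I) (i + 1) 0 (g (i + 1) e) = ∑ a, F.d i a e • g i a := by
  have seq := exists_dependent_sequence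
    (α := fun i => Fin (F.rank i) → polyTower R (R ⧸ I) (i + 1))
    (fun i g => (∀ e j, 1 ≤ j → j ≤ i → face R (R ⧸ I) i j (g e) = 0) ∧
      ∀ e, face R (R ⧸ I) i 0 (∑ a, F.d i a e • g a) = 0)
    (fun i g g' => ∀ e, face R (R ⧸ I) (i + 1) 0 (g' e) = ∑ a, F.d i a e • g a)
    (fun _ => var R (R ⧸ I) 0 1)
  suffices hs : _ ∧ _ by
    obtain ⟨g, h₀, hP, hQ⟩ := seq hs.1 hs.2
    exact ⟨g, fun e => by rw [h₀]; exact face_zero_var _ _, fun i => (hP i).1, hQ⟩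
  constructor
  · refine ⟨fun e j h h' => by omega, fun e => ?_⟩
    simp only [map_sum, map_smul, face_zero_var]
    refine Finset.sum_eq_zero fun a _ => ?_
    rw [Algebra.smul_def, mul_one, algebraMap_zero_eq_zero_iff]
    exact F.d_zero_mem a e
  · rintro i g ⟨hg, hg'⟩
    have key : ∀ e, ∃ w : polyTower R (R ⧸ I) (i + 2),
        face R (R ⧸ I) (i + 1) 0 w = ∑ a, F.d i a e • g a ∧
          ∀ j, 1 ≤ j → j ≤ i + 1 → face R (R ⧸ I) (i + 1) j w = 0 := by
      intro e
      refine exists_face_zero_eq (i + 1) _ fun m j h hj => ?_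
      obtain rfl : i = m := by omega
      rcases Nat.eq_zero_or_pos j with rfl | hj0
      · exact hg' e
      · simp only [map_sum, map_smul]
        exact Finset.sum_eq_zero fun a _ => by rw [hg a j hj0 hj, smul_zero]
    choose w hw hw' using key
    refine ⟨w, ⟨hw', fun e => ?_⟩, hw⟩
    simp only [map_sum, map_smul, hw, Finset.smul_sum, smul_smul]
    rw [Finset.sum_comm]
    refine Finset.sum_eq_zero fun b _ => ?_
    rw [← Finset.sum_smul]
    have h := congrFun (congrFun (F.d_mul_d i) b) e
    rw [Matrix.mul_apply, Matrix.zero_apply] at h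
    simp only [mul_comm (F.d (i + 1) _ e), h, zero_smul]

/-- A chain map from the unnormalized chains of the polynomial resolution to the resolution. -/
lemma exists_map_from_polyTower :
    ∃ h : ∀ i, polyTower R (R ⧸ I) (i + 1) →ₗ[R] (Fin (F.rank i) → R),
    (∀ x, algebraMap R (polyTower R (R ⧸ I) 0) (h 0 x F.basisZero) = face R (R ⧸ I) 0 0 x) ∧
    ∀ i x, F.d i *ᵥ h (i + 1) x = h i (boundary R (R ⧸ I) (i + 1) x) := by
  let ε : (Fin (F.rank 0) → R) →ₗ[R] R ⧸ I :=
    (Submodule.mkQ I).comp (LinearMap.proj F.basisZero)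
  obtain ⟨h₀, hh₀⟩ := exists_lift_of_forall_mem_range (M := polyTower R (R ⧸ I) 1) ε
    (face R (R ⧸ I) 0 0).toLinearMap
    (fun x => by
      obtain ⟨r, hr⟩ := Ideal.Quotient.mk_surjective (I := I) (face R (R ⧸ I) 0 0 x : R ⧸ I)
      exact ⟨fun _ => r, hr⟩)
  have seq := exists_dependent_sequence
    (α := fun i => polyTower R (R ⧸ I) (i + 1) →ₗ[R] (Fin (F.rank i) → R))
    (fun i h => ∀ x, ∃ v, (F.d i).mulVecLin v = (h ∘ₗ boundary R (R ⧸ I) (i + 1)) x)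
    (fun i h h' => ∀ x, F.d i *ᵥ h' x = h (boundary R (R ⧸ I) (i + 1) x)) h₀
  suffices hs : _ ∧ _ by
    obtain ⟨h, e₀, -, hQ⟩ := seq hs.1 hs.2
    exact ⟨h, fun x => by rw [e₀]; exact hh₀ x, hQ⟩
  constructor
  · intro x
    refine F.exists_mulVec_zero_eq ?_
    rw [← algebraMap_zero_eq_zero_iff]
    refine (hh₀ _).trans ?_
    have := boundary_boundary (B := R ⧸ I) 0 x
    rwa [boundary_of_face_eq_zero 0 _ (by omega)] at this
  · intro i h hP
    obtain ⟨h', hh'⟩ := exists_lift_of_forall_mem_range _ _ hP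
    refine ⟨h', fun x => F.exists_mulVec_eq ?_, hh'⟩
    refine (hh' _).trans ?_
    rw [LinearMap.comp_apply, boundary_boundary, map_zero]

/-- In characteristic `p`, a comparison map from the Frobenius twist of a minimal resolution to the
resolution is zero modulo `𝔪` in positive degrees. Up to a homotopy which vanishes modulo `𝔪`, it is
the Frobenius map on a simplicial resolution by polynomial rings; there the `p`-th power of a cycle
`z` modulo `𝔪` is, up to sign, the boundary of `s₀ z * (s₁ z) ^ (p - 1)`. -/
theorem FrobeniusComparison.map_mem {p : ℕ} (hp : p.Prime) [CharP R p] {𝔪 : Ideal R}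
    {F : FreeResolution I} (hF : F.IsMinimal 𝔪) (α : F.FrobeniusComparison p) {i : ℕ} (hi : 1 ≤ i)
    (a b : Fin (F.rank i)) : α.map i a b ∈ 𝔪 := by
  have : Fact p.Prime := ⟨hp⟩
  have hd : ∀ i v a, (F.d i *ᵥ v) a ∈ 𝔪 := fun i v a => by
    rw [Matrix.mulVec, dotProduct]
    exact Ideal.sum_mem _ fun c _ => Ideal.mul_mem_right _ _ (hF i a c)
  obtain ⟨g, hg₀, hg, hgd⟩ := F.exists_map_polyTower
  obtain ⟨h, hh₀, hh⟩ := F.exists_map_from_polyTower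
  -- the Frobenius of the simplicial resolution vanishes modulo `𝔪`
  have hU : ∀ i e a, h (i + 1) (g (i + 1) e ^ p) a ∈ 𝔪 := by
    intro i e a
    set z := g (i + 1) e with hz
    set y := degen₀ R (R ⧸ I) (i + 1) z * degen₁ R (R ⧸ I) i z ^ (p - 1) with hy
    have hy0 : face R (R ⧸ I) (i + 2) 0 y =
        ∑ c, F.d i c e • (degen₀ R (R ⧸ I) i (g i c) * z *
          degen₀ R (R ⧸ I) i (face R (R ⧸ I) (i + 1) 0 z) ^ (p - 2)) := by
      rw [hy, map_mul, map_pow, face_zero_degen₀, face_zero_degen₁,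
        show p - 1 = (p - 2) + 1 by have := hp.two_le; omega, pow_succ]
      nth_rewrite 2 [hz]
      rw [hgd]
      simp only [map_sum, map_smul, Finset.mul_sum]
      refine Finset.sum_congr rfl fun c _ => ?_
      simp only [Algebra.smul_def]
      ring
    have hy1 : face R (R ⧸ I) (i + 2) 1 y = z ^ p := by
      rw [hy, map_mul, map_pow, face_one_degen₀, face_one_degen₁, ← pow_succ',
        Nat.sub_add_cancel hp.one_le]
    have hy2 : ∀ j, j + 2 ≤ i + 2 → face R (R ⧸ I) (i + 2) (j + 2) y = 0 := by
      intro j hj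
      rw [hy, map_mul, face_degen₀, hg (i + 1) e (j + 1) (by omega) (by omega), _root_.map_zero,
        zero_mul]
    have hb : boundary R (R ⧸ I) (i + 2) y = face R (R ⧸ I) (i + 2) 0 y - z ^ p := by
      rw [boundary_apply, Finset.sum_range_succ', Finset.sum_range_succ', Finset.sum_eq_zero]
      · rw [zero_add, zero_add, hy1, pow_one, pow_zero, one_smul, neg_one_smul]
        ring
      · intro j hj
        rw [hy2 j (by simpa using hj), smul_zero]
    have hzp : z ^ p = face R (R ⧸ I) (i + 2) 0 y - boundary R (R ⧸ I) (i + 2) y := by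
      rw [hb]; ring
    rw [hzp, map_sub, ← hh, Pi.sub_apply]
    refine Ideal.sub_mem _ ?_ (hd _ _ _)
    rw [hy0, map_sum, Finset.sum_apply]
    refine Ideal.sum_mem _ fun c _ => ?_
    rw [map_smul, Pi.smul_apply, smul_eq_mul]
    exact Ideal.mul_mem_right _ _ (hF i c e)
  -- the two semilinear lifts of the Frobenius of `R ⧸ I` are homotopic
  have key : ∀ i, ∃ (s : Fin (F.rank i) → Fin (F.rank (i + 1)) → R)
      (T : Fin (F.rank i) → Fin (F.rank i) → R),
      (∀ e, (α.map i).col e - h i (g i e ^ p) = F.d i *ᵥ s e + T e) ∧ (∀ e a, T e a ∈ 𝔪) ∧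
      ∀ e, ∑ a, F.d i a e ^ p • T a = 0 := by
    intro i
    induction i with
    | zero =>
      have : ∀ e, ∃ s, F.d 0 *ᵥ s = (α.map 0).col e - h 0 (g 0 e ^ p) := by
        intro e
        refine F.exists_mulVec_zero_eq ?_
        rw [← algebraMap_zero_eq_zero_iff, Pi.sub_apply, map_sub, hh₀, map_pow, hg₀, one_pow,
          α.map_zero, F.eq_of_fin_rank_zero e F.basisZero, Matrix.col_apply, Matrix.one_apply_eq,
          map_one, sub_self]
      choose s hs using this
      exact ⟨s, 0, fun e => by rw [hs]; simp, fun e a => by simp, fun e => by simp⟩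
    | succ i ih =>
      obtain ⟨s, T, hsT, -, hT⟩ := ih
      have hdd : ∀ c e, ∑ a, F.d i c a ^ p * F.d (i + 1) a e ^ p = 0 := by
        intro c e
        have h := congrFun (congrFun (F.d_mul_d i) c) e
        rw [Matrix.mul_apply, Matrix.zero_apply] at h
        simp only [← mul_pow]
        rw [← sum_pow_char, h, zero_pow hp.ne_zero]
      have : ∀ e, ∃ s', F.d (i + 1) *ᵥ s' = (α.map (i + 1)).col e - h (i + 1) (g (i + 1) e ^ p) -
          ∑ a, F.d i a e ^ p • s a := by
        intro e
        refine F.exists_mulVec_eq ?_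
        have : CharP (polyTower R (R ⧸ I) (i + 1)) p :=
          inferInstanceAs (CharP (MvPolynomial (polyTower R (R ⧸ I) i) R) p)
        have e1 : F.d i *ᵥ (α.map (i + 1)).col e = ∑ a, F.d i a e ^ p • (α.map i).col a := by
          have := α.comm i
          funext c
          have := congrFun (congrFun this c) e
          rw [Matrix.mul_apply, Matrix.mul_apply] at this
          simp only [Matrix.mulVec, dotProduct, Matrix.col_apply, Finset.sum_apply, Pi.smul_apply,
            smul_eq_mul]
          rw [this]
          exact Finset.sum_congr rfl fun x _ => mul_comm _ _
        have e2 : F.d i *ᵥ h (i + 1) (g (i + 1) e ^ p) = ∑ a, F.d i a e ^ p • h i (g i a ^ p) := by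
          rw [hh, boundary_of_face_eq_zero _ _ (fun j h1 h2 => by
            rw [map_pow, hg _ _ _ h1 h2, zero_pow hp.ne_zero]), map_pow, hgd, sum_pow_char]
          simp only [smul_pow, map_sum, map_smul]
        have e3 : F.d i *ᵥ ∑ a, F.d i a e ^ p • s a =
            ∑ a, F.d i a e ^ p • ((α.map i).col a - h i (g i a ^ p)) := by
          simp only [hsT, smul_add, Finset.sum_add_distrib, hT, add_zero]
          simp only [← Matrix.mulVecLin_apply, map_sum, map_smul]
        rw [Matrix.mulVec_sub, Matrix.mulVec_sub, e1, e2, e3, ← Finset.sum_sub_distrib]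
        simp only [smul_sub]
        rw [Finset.sum_sub_distrib, sub_self]
      choose s' hs' using this
      refine ⟨s', fun e => ∑ a, F.d i a e ^ p • s a, fun e => by rw [hs']; abel, fun e a => ?_,
        fun e => ?_⟩
      · dsimp only
        rw [Finset.sum_apply]
        exact Ideal.sum_mem _ fun c _ => Ideal.mul_mem_right _ _
          (Ideal.pow_mem_of_mem _ (hF i c e) _ hp.pos)
      · simp only [Finset.smul_sum, smul_smul]
        rw [Finset.sum_comm]
        refine Finset.sum_eq_zero fun c _ => ?_
        rw [← Finset.sum_smul]
        simp only [mul_comm (F.d (i + 1) _ e ^ p), hdd, zero_smul]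
  obtain ⟨s, T, hsT, hT, -⟩ := key i
  obtain ⟨i, rfl⟩ : ∃ k, i = k + 1 := ⟨i - 1, by omega⟩
  have h1 := congrFun (hsT b) a
  rw [Pi.sub_apply, sub_eq_iff_eq_add, Matrix.col_apply, Pi.add_apply] at h1
  rw [h1]
  exact Ideal.add_mem _ (Ideal.add_mem _ (hd _ _ _) (hT b a)) (hU i b a)

end FreeResolution

/-! ### Vectors modulo an ideal and regular sequences -/

namespace Ideal

variable {R : Type u} [CommRing R]

/-- The vectors all of whose coordinates lie in `𝔞`. -/
def vec (𝔞 : Ideal R) (κ : Type) : Submodule R (κ → R) where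
  carrier := {v | ∀ a, v a ∈ 𝔞}
  add_mem' h h' a := 𝔞.add_mem (h a) (h' a)
  zero_mem' _ := 𝔞.zero_mem
  smul_mem' r _ h a := 𝔞.mul_mem_left r (h a)

variable {𝔞 𝔟 : Ideal R} {κ μ : Type}

lemma mem_vec {v : κ → R} : v ∈ 𝔞.vec κ ↔ ∀ a, v a ∈ 𝔞 := Iff.rfl

lemma vec_mono (h : 𝔞 ≤ 𝔟) : 𝔞.vec κ ≤ 𝔟.vec κ := fun _ hv a => h (hv a)

@[simp] lemma vec_bot : (⊥ : Ideal R).vec κ = ⊥ := by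
  ext v
  simp [mem_vec, funext_iff]

lemma smul_mem_vec {x : R} (hx : x ∈ 𝔞) (v : κ → R) : x • v ∈ 𝔞.vec κ :=
  fun _ => 𝔞.mul_mem_right _ hx

lemma mulVec_mem_vec [Fintype κ] (D : Matrix μ κ R) {v : κ → R} (hv : v ∈ 𝔞.vec κ) :
    D *ᵥ v ∈ 𝔞.vec μ := fun a => by
  rw [Matrix.mulVec, dotProduct]
  exact sum_mem _ fun c _ => mul_mem_left _ _ (hv c)

lemma vecMul_mem_vec [Fintype κ] (D : Matrix κ μ R) {v : κ → R} (hv : v ∈ 𝔞.vec κ) :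
    v ᵥ* D ∈ 𝔞.vec μ := fun a => by
  rw [Matrix.vecMul, dotProduct]
  exact sum_mem _ fun c _ => mul_mem_right _ _ (hv c)

lemma mulVec_mem_vec_of_entries [Fintype κ] {D : Matrix μ κ R} (hD : ∀ a b, D a b ∈ 𝔞)
    (v : κ → R) : D *ᵥ v ∈ 𝔞.vec μ := fun a => by
  rw [Matrix.mulVec, dotProduct]
  exact sum_mem _ fun c _ => mul_mem_right _ _ (hD a c)

lemma exists_sub_smul_mem_vec {x : R} {v : κ → R} (hv : v ∈ (𝔞 ⊔ span {x}).vec κ) :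
    ∃ u, v - x • u ∈ 𝔞.vec κ := by
  have : ∀ a, ∃ u, v a - x * u ∈ 𝔞 := by
    intro a
    obtain ⟨y, hy, z, hz, hyz⟩ := Submodule.mem_sup.1 (hv a)
    obtain ⟨u, rfl⟩ := mem_span_singleton'.1 hz
    refine ⟨u, ?_⟩
    rw [← hyz, mul_comm x, add_sub_cancel_right]
    exact hy
  choose u hu using this
  exact ⟨u, hu⟩

lemma mem_vec_sup_span {x : R} {u v : κ → R} (h : v - x • u ∈ 𝔞.vec κ) :
    v ∈ (𝔞 ⊔ span {x}).vec κ := by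
  rw [← sub_add_cancel v (x • u)]
  exact Submodule.add_mem _ (vec_mono le_sup_left h)
    (smul_mem_vec (le_sup_right (a := 𝔞) (mem_span_singleton_self x)) u)

/-- Multiplication by `x` is injective on `R ⧸ 𝔞`. -/
def IsRegularMod (𝔞 : Ideal R) (x : R) : Prop := ∀ a, x * a ∈ 𝔞 → a ∈ 𝔞

lemma IsRegularMod.mem_vec {x : R} (hx : 𝔞.IsRegularMod x) {v : κ → R} (h : x • v ∈ 𝔞.vec κ) :
    v ∈ 𝔞.vec κ := fun a => hx _ (h a)

/-- The sequence `rs` is weakly regular on `R ⧸ 𝔞`. -/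
def IsRegularSeqMod : Ideal R → List R → Prop
  | _, [] => True
  | 𝔞, r :: rs => 𝔞.IsRegularMod r ∧ IsRegularSeqMod (𝔞 ⊔ span {r}) rs

lemma isRegularSeqMod_iff (𝔞 : Ideal R) (rs : List R) : 𝔞.IsRegularSeqMod rs ↔
    ∀ i (hi : i < rs.length), (𝔞 ⊔ ofList (rs.take i)).IsRegularMod rs[i] := by
  induction rs generalizing 𝔞 with
  | nil => simp [IsRegularSeqMod]
  | cons r rs ih =>
    rw [IsRegularSeqMod, ih]
    constructor
    · rintro ⟨h₀, h⟩ (_ | i) hi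
      · simpa using h₀
      · simpa [sup_assoc] using h i (by simpa using hi)
    · intro h
      refine ⟨?_, fun i hi => ?_⟩
      · have h₀ := h 0 (by simp)
        rwa [List.take_zero, ofList_nil, sup_bot_eq] at h₀
      · have h₁ := h (i + 1) (by simpa using hi)
        rwa [List.take_succ_cons, ofList_cons, ← sup_assoc] at h₁

lemma ofList_take_succ (rs : List R) (i : ℕ) (hi : i < rs.length) :
    ofList (rs.take (i + 1)) = ofList (rs.take i) ⊔ span {rs[i]} := by
  rw [List.take_succ_eq_append_getElem hi, ofList_append, ofList_singleton]

lemma IsRegularSeqMod.isRegularMod_getElem {rs : List R} (h : (⊥ : Ideal R).IsRegularSeqMod rs)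
    {i : ℕ} (hi : i < rs.length) : (ofList (rs.take i)).IsRegularMod rs[i] := by
  simpa using (isRegularSeqMod_iff _ _).1 h i hi

end Ideal

/-! ### Complexes of based free modules -/

/-- A complex `⋯ → R ^ ι 2 → R ^ ι 1 → R ^ ι 0` of finite free modules with bases, where `ι 0` has
exactly one element. Unlike in `FreeResolution`, the bases may be indexed by arbitrary finite types,
which makes mapping cones convenient. -/
structure BasedComplex (R : Type u) [CommRing R] where
  /-- The index types of the bases. -/
  ι : ℕ → Type
  [fintype : ∀ i, Fintype (ι i)]
  [decEq : ∀ i, DecidableEq (ι i)]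
  [unique : Unique (ι 0)]
  /-- The matrices of the differentials. -/
  d : ∀ i, Matrix (ι i) (ι (i + 1)) R
  d_mul_d : ∀ i, d i * d (i + 1) = 0

namespace BasedComplex

attribute [instance] fintype decEq unique

variable {R : Type u} [CommRing R]

/-- The complex is a resolution of `R ⧸ I`. -/
structure IsResolution (C : BasedComplex R) (I : Ideal R) : Prop where
  exact : ∀ i v, C.d i *ᵥ v = 0 → ∃ w, C.d (i + 1) *ᵥ w = v
  mem_iff : ∀ x, x ∈ I ↔ ∃ w, (C.d 0 *ᵥ w) default = x

/-- All entries of the differentials lie in `𝔪`. -/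
def IsMinimal (C : BasedComplex R) (𝔪 : Ideal R) : Prop := ∀ i a b, C.d i a b ∈ 𝔪

/-- The homology of `C ⊗ R ⧸ 𝔞` in degree `i + 1` vanishes. -/
def ExactMod (C : BasedComplex R) (𝔞 : Ideal R) (i : ℕ) : Prop :=
  ∀ v, C.d i *ᵥ v ∈ 𝔞.vec _ → ∃ w, v - C.d (i + 1) *ᵥ w ∈ 𝔞.vec _

/-- The coboundaries in degree `i` of the dual complex. -/
def coboundaries (C : BasedComplex R) : ∀ i, Submodule R (C.ι i → R)
  | 0 => ⊥
  | i + 1 => LinearMap.range (C.d i).vecMulLinear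

/-- The cohomology of `Hom(C, R ⧸ 𝔞)` in degree `i` vanishes. -/
def CoexactMod (C : BasedComplex R) (𝔞 : Ideal R) (i : ℕ) : Prop :=
  ∀ v, v ᵥ* C.d i ∈ 𝔞.vec _ → v ∈ C.coboundaries i ⊔ 𝔞.vec _

variable {C : BasedComplex R} {I 𝔞 : Ideal R} {x : R}

lemma mulVec_mulVec (i : ℕ) (v : C.ι (i + 2) → R) : C.d i *ᵥ C.d (i + 1) *ᵥ v = 0 := by
  rw [Matrix.mulVec_mulVec, C.d_mul_d, Matrix.zero_mulVec]

lemma IsResolution.exists_mulVec_zero_eq (hC : C.IsResolution I) {v : C.ι 0 → R}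
    (hv : v default ∈ I) : ∃ w, C.d 0 *ᵥ w = v := by
  obtain ⟨w, hw⟩ := (hC.mem_iff _).1 hv
  exact ⟨w, funext fun a => by rw [Unique.eq_default a, hw]⟩

lemma IsResolution.exactMod_bot (hC : C.IsResolution I) (i : ℕ) : C.ExactMod ⊥ i := by
  intro v hv
  obtain ⟨w, rfl⟩ := hC.exact i v (by simpa using hv)
  exact ⟨w, by simp⟩

lemma ExactMod.sup_span {i : ℕ} (h : C.ExactMod 𝔞 i) (h' : C.ExactMod 𝔞 (i + 1))
    (hx : 𝔞.IsRegularMod x) : C.ExactMod (𝔞 ⊔ Ideal.span {x}) (i + 1) := by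
  intro v hv
  obtain ⟨u, hu⟩ := Ideal.exists_sub_smul_mem_vec hv
  have h1 : C.d i *ᵥ u ∈ 𝔞.vec _ := by
    refine hx.mem_vec ?_
    have := Ideal.mulVec_mem_vec (C.d i) hu
    rw [Matrix.mulVec_sub, mulVec_mulVec, Matrix.mulVec_smul, zero_sub] at this
    exact (Submodule.neg_mem_iff _).1 this
  obtain ⟨w, hw⟩ := h u h1
  obtain ⟨w', hw'⟩ := h' (v - x • w) (by
    have := Submodule.add_mem _ hu (Submodule.smul_mem _ x hw)
    rw [Matrix.mulVec_sub, Matrix.mulVec_smul]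
    convert this using 1
    rw [smul_sub]
    abel)
  refine ⟨w', Ideal.mem_vec_sup_span (u := w) ?_⟩
  convert hw' using 1
  abel

lemma IsResolution.exactMod_ofList (hC : C.IsResolution I) {rs : List R}
    (hrs : (⊥ : Ideal R).IsRegularSeqMod rs) (j : ℕ) (hj : j ≤ rs.length) (i : ℕ) (hi : j ≤ i) :
    C.ExactMod (Ideal.ofList (rs.take j)) i := by
  induction j generalizing i with
  | zero => simpa using hC.exactMod_bot i
  | succ j ih =>
    obtain ⟨i, rfl⟩ : ∃ k, i = k + 1 := ⟨i - 1, by omega⟩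
    rw [Ideal.ofList_take_succ rs j hj]
    exact (ih (by omega) i (by omega)).sup_span (ih (by omega) (i + 1) (by omega))
      (hrs.isRegularMod_getElem hj)

/-! ### The socle -/

/-- The cycles modulo `𝔞`. -/
def IsCycleMod (C : BasedComplex R) (𝔞 : Ideal R) : ∀ i, (C.ι i → R) → Prop
  | 0, _ => True
  | i + 1, v => C.d i *ᵥ v ∈ 𝔞.vec _

lemma isCycleMod_of_smul {i : ℕ} {v : C.ι (i + 1) → R} {u : C.ι i → R}
    (h : C.d i *ᵥ v - x • u ∈ 𝔞.vec _) (hx : 𝔞.IsRegularMod x) : C.IsCycleMod 𝔞 i u := by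
  cases i with
  | zero => trivial
  | succ i =>
    refine hx.mem_vec ?_
    have := Ideal.mulVec_mem_vec (C.d i) h
    rw [Matrix.mulVec_sub, mulVec_mulVec, Matrix.mulVec_smul, zero_sub] at this
    exact (Submodule.neg_mem_iff _).1 this

/-- If `C` resolves `R ⧸ J` and `rs` is a regular sequence, then the homology of
`C ⊗ R ⧸ (r₁, …, rⱼ)` in degree `j` is isomorphic to the submodule of `R ⧸ J` annihilated by
`r₁, …, rⱼ`. The isomorphism is given as a relation `P` between cycles and representatives in
`R`. -/
lemma IsResolution.exists_homology_relation {J : Ideal R} (hC : C.IsResolution J) {rs : List R}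
    (hrs : (⊥ : Ideal R).IsRegularSeqMod rs) (j : ℕ) (hj : j ≤ rs.length) :
    ∃ P : Submodule R ((C.ι j → R) × R),
      (∀ v, C.IsCycleMod (Ideal.ofList (rs.take j)) j v → ∃ a, (v, a) ∈ P) ∧
      (∀ v a, (v, a) ∈ P → ∀ r ∈ Ideal.ofList (rs.take j), r * a ∈ J) ∧
      (∀ a, (∀ r ∈ Ideal.ofList (rs.take j), r * a ∈ J) → ∃ v, (v, a) ∈ P) ∧
      ∀ v a, (v, a) ∈ P →
        (a ∈ J ↔ ∃ w, v - C.d j *ᵥ w ∈ (Ideal.ofList (rs.take j)).vec _) := by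
  induction j with
  | zero =>
    refine ⟨Submodule.comap ((LinearMap.proj default).comp (LinearMap.fst R (C.ι 0 → R) R) -
      LinearMap.snd R _ R) J, fun v _ => ⟨v default, by simp⟩, ?_, fun a _ => ⟨fun _ => a, by simp⟩,
      ?_⟩
    · intro v a _ r hr
      simp only [List.take_zero, Ideal.ofList_nil, Ideal.mem_bot] at hr
      simp [hr]
    · intro v a hva
      replace hva : v default - a ∈ J := by simpa using hva
      simp only [List.take_zero, Ideal.ofList_nil, Ideal.vec_bot, Submodule.mem_bot, sub_eq_zero]
      constructor
      · intro ha
        have : v default ∈ J := by simpa using J.add_mem hva ha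
        obtain ⟨w, hw⟩ := hC.exists_mulVec_zero_eq this
        exact ⟨w, hw.symm⟩
      · rintro ⟨w, rfl⟩
        have := (hC.mem_iff _).2 ⟨w, rfl⟩
        simpa using J.sub_mem this hva
  | succ j ih =>
    obtain ⟨P, h1, h2, h3, h4⟩ := ih (by omega)
    have hx := hrs.isRegularMod_getElem (i := j) hj
    have hex := hC.exactMod_ofList hrs j (by omega) j le_rfl
    rw [Ideal.ofList_take_succ rs j hj]
    generalize rs[j] = x at *
    generalize Ideal.ofList (rs.take j) = 𝔞 at *
    refine ⟨{
      carrier := {q | ∃ u, C.d j *ᵥ q.1 - x • u ∈ 𝔞.vec _ ∧ (u, q.2) ∈ P}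
      add_mem' := ?_
      zero_mem' := ⟨0, by simp, P.zero_mem⟩
      smul_mem' := ?_ }, ?_, ?_, ?_, ?_⟩
    · rintro q q' ⟨u, hu, hP⟩ ⟨u', hu', hP'⟩
      refine ⟨u + u', ?_, P.add_mem hP hP'⟩
      convert Submodule.add_mem _ hu hu' using 1
      rw [Prod.fst_add, Matrix.mulVec_add, smul_add]
      abel
    · rintro r q ⟨u, hu, hP⟩
      refine ⟨r • u, ?_, P.smul_mem r hP⟩
      convert Submodule.smul_mem _ r hu using 1
      rw [Prod.smul_fst, Matrix.mulVec_smul, smul_sub, smul_comm]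
    · intro v hv
      obtain ⟨u, hu⟩ := Ideal.exists_sub_smul_mem_vec hv
      obtain ⟨a, ha⟩ := h1 u (isCycleMod_of_smul hu hx)
      exact ⟨a, u, hu, ha⟩
    · rintro v a ⟨u, hu, hP⟩ r hr
      obtain ⟨r', hr', z, hz, rfl⟩ := Submodule.mem_sup.1 hr
      obtain ⟨t, rfl⟩ := Ideal.mem_span_singleton'.1 hz
      rw [add_mul, mul_assoc]
      refine J.add_mem (h2 u a hP r' hr') (J.mul_mem_left t ?_)
      refine (h4 (x • u) (x * a) (P.smul_mem x hP)).2 ⟨v, ?_⟩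
      rw [← neg_sub]
      exact Submodule.neg_mem _ hu
    · intro a ha
      obtain ⟨u, hu⟩ := h3 a fun r hr => ha r (le_sup_left (b := Ideal.span {x}) hr)
      obtain ⟨w, hw⟩ := (h4 (x • u) (x * a) (P.smul_mem x hu)).1
        (ha x (le_sup_right (a := 𝔞) (Ideal.mem_span_singleton_self x)))
      refine ⟨w, u, ?_, hu⟩
      rw [← neg_sub]
      exact Submodule.neg_mem _ hw
    · rintro v a ⟨u, hu, hP⟩
      rw [h4 u a hP]
      constructor
      · rintro ⟨w, hw⟩
        obtain ⟨w', hw'⟩ := hex (v - x • w) (by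
          have := Submodule.add_mem _ hu (Submodule.smul_mem _ x hw)
          rw [Matrix.mulVec_sub, Matrix.mulVec_smul]
          convert this using 1
          rw [smul_sub]
          abel)
        refine ⟨w', Ideal.mem_vec_sup_span (u := w) ?_⟩
        convert hw' using 1
        abel
      · rintro ⟨w, hw⟩
        obtain ⟨v', hv'⟩ := Ideal.exists_sub_smul_mem_vec hw
        refine ⟨v', hx.mem_vec ?_⟩
        have := Submodule.sub_mem _ (Ideal.mulVec_mem_vec (C.d j) hv') hu
        rw [Matrix.mulVec_sub, Matrix.mulVec_sub, mulVec_mulVec, Matrix.mulVec_smul] at this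
        convert this using 1
        rw [smul_sub]
        abel

section Local

variable [IsLocalRing R]

open IsLocalRing

/-- A minimal resolution over a local ring whose maximal ideal is generated by a regular sequence
has at most the length of that sequence. -/
lemma IsResolution.isEmpty_of_length_lt (hC : C.IsResolution I) {rs : List R}
    (hrs : (⊥ : Ideal R).IsRegularSeqMod rs) (hm : Ideal.ofList rs = maximalIdeal R)
    (hmin : C.IsMinimal (maximalIdeal R)) {i : ℕ} (hi : rs.length < i) : IsEmpty (C.ι i) := by
  refine ⟨fun e => ?_⟩
  obtain ⟨i, rfl⟩ : ∃ k, i = k + 1 := ⟨i - 1, by omega⟩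
  have h := hC.exactMod_ofList hrs rs.length le_rfl i (by omega)
  rw [List.take_length, hm] at h
  obtain ⟨w, hw⟩ := h (Pi.single e 1) (Ideal.mulVec_mem_vec_of_entries (hmin i) _)
  have h1 := Submodule.add_mem _ hw (Ideal.mulVec_mem_vec_of_entries (hmin (i + 1)) w)
  rw [sub_add_cancel] at h1
  exact (maximalIdeal.isMaximal R).ne_top ((Ideal.eq_top_iff_one _).2 (by simpa using h1 e))

/-- The last module in the minimal resolution of `R ⧸ J` has rank one if `J` is an irreducible ideal
primary to the maximal ideal: its basis corresponds to a basis of the socle of `R ⧸ J`. -/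
lemma IsResolution.card_length_eq_one {J : Ideal R} (hC : C.IsResolution J) {rs : List R}
    (hrs : (⊥ : Ideal R).IsRegularSeqMod rs) (hm : Ideal.ofList rs = maximalIdeal R)
    (hmin : C.IsMinimal (maximalIdeal R)) (hJ : InfIrred J) {N : ℕ}
    (hN : maximalIdeal R ^ N ≤ J) : Fintype.card (C.ι rs.length) = 1 := by
  obtain ⟨P, h1, h2, h3, h4⟩ := hC.exists_homology_relation hrs rs.length le_rfl
  rw [List.take_length, hm] at h1 h2 h3 h4
  have hcyc : ∀ v, C.IsCycleMod (maximalIdeal R) rs.length v := by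
    cases rs.length with
    | zero => exact fun _ => trivial
    | succ n => exact Ideal.mulVec_mem_vec_of_entries (hmin n)
  have h4' : ∀ v a, (v, a) ∈ P → (a ∈ J ↔ v ∈ (maximalIdeal R).vec _) := by
    intro v a hva
    rw [h4 v a hva]
    refine ⟨fun ⟨w, hw⟩ => ?_, fun hv => ⟨0, by simpa using hv⟩⟩
    have h1 := Submodule.add_mem _ hw (Ideal.mulVec_mem_vec_of_entries (hmin _) w)
    rwa [sub_add_cancel] at h1
  have hJtop : J ≠ ⊤ := fun h => hJ.1 (h ▸ isMax_top)
  have hone : (1 : R) ∉ maximalIdeal R := fun h =>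
    (maximalIdeal.isMaximal R).ne_top ((Ideal.eq_top_iff_one _).2 h)
  -- the socle is nonzero
  have hne : Nonempty (C.ι rs.length) := by
    by_contra hempty
    rw [not_nonempty_iff] at hempty
    have : ∀ n, maximalIdeal R ^ n ≤ J → J = ⊤ := by
      intro n
      induction n with
      | zero => intro h; simpa using h
      | succ n ih =>
        intro h
        refine ih fun a ha => ?_
        obtain ⟨v, hv⟩ := h3 a fun r hr => h (by rw [pow_succ']; exact Ideal.mul_mem_mul hr ha)
        exact (h4' v a hv).2 fun e => hempty.elim e
    exact hJtop (this N hN)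
  have hsub : Subsingleton (C.ι rs.length) := by
    refine ⟨fun e e' => ?_⟩
    by_contra hee
    obtain ⟨a, ha⟩ := h1 (Pi.single e 1) (hcyc _)
    obtain ⟨a', ha'⟩ := h1 (Pi.single e' 1) (hcyc _)
    have hmem : ∀ r r', r * a - r' * a' ∈ J → r * a ∈ J := by
      intro r r' h
      have hv := (h4' _ _ (P.sub_mem (P.smul_mem r ha) (P.smul_mem r' ha'))).1 h e
      refine h2 _ _ ha r ?_
      simpa [hee] using hv
    have hinf : (J ⊔ Ideal.span {a}) ⊓ (J ⊔ Ideal.span {a'}) = J := by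
      refine le_antisymm ?_ (le_inf le_sup_left le_sup_left)
      rintro z ⟨hz, hz'⟩
      obtain ⟨j, hj, _, hr, rfl⟩ := Submodule.mem_sup.1 hz
      obtain ⟨r, rfl⟩ := Ideal.mem_span_singleton'.1 hr
      obtain ⟨j', hj', _, hr', hz''⟩ := Submodule.mem_sup.1 hz'
      obtain ⟨r', rfl⟩ := Ideal.mem_span_singleton'.1 hr'
      refine J.add_mem hj (hmem r r' ?_)
      have : r * a - r' * a' = j' - j := by linear_combination -hz''
      rw [this]
      exact J.sub_mem hj' hj
    rcases hJ.2 hinf with h | h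
    · have ha0 : a ∈ J := h.le (le_sup_right (a := J) (Ideal.mem_span_singleton_self a))
      exact hone (by simpa using (h4' _ _ ha).1 ha0 e)
    · have ha0 : a' ∈ J := h.le (le_sup_right (a := J) (Ideal.mem_span_singleton_self a'))
      exact hone (by simpa using (h4' _ _ ha').1 ha0 e')
  exact le_antisymm (Fintype.card_le_one_iff_subsingleton.2 hsub) Fintype.card_pos

end Local

end BasedComplex

/-! ### The dual complex -/

namespace BasedComplex

variable {R : Type u} [CommRing R] {C : BasedComplex R} {I J 𝔞 : Ideal R} {x : R}

lemma vecMul_vecMul (i : ℕ) (v : C.ι i → R) : v ᵥ* C.d i ᵥ* C.d (i + 1) = 0 := by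
  rw [Matrix.vecMul_vecMul, C.d_mul_d, Matrix.vecMul_zero]

lemma vecMul_eq_zero_of_mem_coboundaries {i : ℕ} {v : C.ι i → R} (hv : v ∈ C.coboundaries i) :
    v ᵥ* C.d i = 0 := by
  cases i with
  | zero => rw [(Submodule.mem_bot R).1 hv, Matrix.zero_vecMul]
  | succ i =>
    obtain ⟨w, rfl⟩ := hv
    exact vecMul_vecMul i w

/-- Multiplication by an element of `J` is null-homotopic on a resolution of `R ⧸ J`. -/
lemma IsResolution.exists_homotopy (hC : C.IsResolution J) {f : R} (hf : f ∈ J) :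
    ∃ s : ∀ i, Matrix (C.ι (i + 1)) (C.ι i) R, C.d 0 * s 0 = f • (1 : Matrix _ _ R) ∧
      ∀ i, C.d (i + 1) * s (i + 1) + s i * C.d i = f • (1 : Matrix _ _ R) := by
  obtain ⟨w, hw⟩ := hC.exists_mulVec_zero_eq (v := fun _ => f) hf
  let s₀ : Matrix (C.ι 1) (C.ι 0) R := fun a _ => w a
  have hs₀ : C.d 0 * s₀ = f • (1 : Matrix _ _ R) := by
    ext a b
    rw [Unique.eq_default a, Unique.eq_default b, Matrix.smul_apply, Matrix.one_apply_eq,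
      smul_eq_mul, mul_one]
    exact congrFun hw default
  have seq := exists_dependent_sequence (α := fun i => Matrix (C.ι (i + 1)) (C.ι i) R)
    (fun i s => C.d i * (s * C.d i) = f • C.d i)
    (fun i s s' => C.d (i + 1) * s' + s * C.d i = f • (1 : Matrix _ _ R)) s₀
  obtain ⟨s, e₀, -, hs⟩ := seq (by rw [← Matrix.mul_assoc, hs₀, Matrix.smul_mul, Matrix.one_mul])
    (by
      intro i s hs
      have : ∀ e, ∃ w, C.d (i + 1) *ᵥ w = (f • (1 : Matrix _ _ R) - s * C.d i).col e := by
        intro e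
        refine hC.exact i _ ?_
        have h0 : C.d i * (f • (1 : Matrix _ _ R) - s * C.d i) = 0 := by
          rw [Matrix.mul_sub, hs, Matrix.mul_smul, Matrix.mul_one, sub_self]
        funext a
        exact congrFun (congrFun h0 a) e
      choose w hw using this
      have hs' : C.d (i + 1) * (Matrix.of fun a e => w e a) =
          f • (1 : Matrix _ _ R) - s * C.d i := by
        ext a e
        exact congrFun (hw e) a
      refine ⟨Matrix.of fun a e => w e a, ?_, by rw [hs', sub_add_cancel]⟩
      rw [← Matrix.mul_assoc, hs', Matrix.sub_mul, Matrix.mul_assoc, C.d_mul_d, Matrix.mul_zero,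
        sub_zero, Matrix.smul_mul, Matrix.one_mul])
  exact ⟨s, by rw [e₀, hs₀], hs⟩

/-- If `C` resolves `R ⧸ J`, then `J` annihilates the cohomology of `Hom(C, R ⧸ 𝔞)`. -/
lemma IsResolution.smul_mem_coboundaries (hC : C.IsResolution J) {f : R} (hf : f ∈ J) {i : ℕ}
    {v : C.ι i → R} (hv : v ᵥ* C.d i ∈ 𝔞.vec _) : f • v ∈ C.coboundaries i ⊔ 𝔞.vec _ := by
  obtain ⟨s, hs₀, hs⟩ := hC.exists_homotopy hf
  have hv1 : f • v = v ᵥ* (f • (1 : Matrix _ _ R)) := by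
    rw [Matrix.vecMul_smul, Matrix.vecMul_one]
  rw [hv1]
  cases i with
  | zero =>
    rw [← hs₀, ← Matrix.vecMul_vecMul]
    exact Submodule.mem_sup_right (Ideal.vecMul_mem_vec _ hv)
  | succ i =>
    rw [← hs i, Matrix.vecMul_add, ← Matrix.vecMul_vecMul, ← Matrix.vecMul_vecMul]
    exact Submodule.add_mem _ (Submodule.mem_sup_right (Ideal.vecMul_mem_vec _ hv))
      (Submodule.mem_sup_left ⟨v ᵥ* s i, rfl⟩)

lemma exists_sub_smul_vecMul_mem_vec {i : ℕ} {w : C.ι i → R}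
    (hw : w ∈ C.coboundaries i ⊔ (𝔞 ⊔ Ideal.span {x}).vec _) :
    ∃ u, w ᵥ* C.d i - x • (u ᵥ* C.d i) ∈ 𝔞.vec _ := by
  obtain ⟨b, hb, z, hz, rfl⟩ := Submodule.mem_sup.1 hw
  obtain ⟨u, hu⟩ := Ideal.exists_sub_smul_mem_vec hz
  refine ⟨u, ?_⟩
  rw [Matrix.add_vecMul, vecMul_eq_zero_of_mem_coboundaries hb, zero_add, ← Matrix.smul_vecMul,
    ← Matrix.sub_vecMul]
  exact Ideal.vecMul_mem_vec _ hu

/-- One step in the computation of the cohomology of the dual of a resolution of `R ⧸ J`: on the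
cohomology of `Hom(C, R ⧸ 𝔞)` in degree `i`, multiplication by `x` is both nilpotent and, if the
cohomology of `Hom(C, R ⧸ (𝔞 + (x)))` in degree `i - 1` vanishes, injective. -/
lemma IsResolution.coexactMod_of_sup_span (hC : C.IsResolution J) (hx : 𝔞.IsRegularMod x) {N : ℕ}
    (hN : x ^ N ∈ J) {i : ℕ} (h : ∀ k, i = k + 1 → C.CoexactMod (𝔞 ⊔ Ideal.span {x}) k) :
    C.CoexactMod 𝔞 i := by
  intro v hv
  have inj : ∀ v, x • v ∈ C.coboundaries i ⊔ 𝔞.vec _ → v ∈ C.coboundaries i ⊔ 𝔞.vec _ := by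
    intro v hv
    obtain ⟨b, hb, z, hz, hbz⟩ := Submodule.mem_sup.1 hv
    cases i with
    | zero =>
      rw [(Submodule.mem_bot R).1 hb, zero_add] at hbz
      rw [hbz] at hz
      exact Submodule.mem_sup_right (hx.mem_vec hz)
    | succ k =>
      obtain ⟨w, rfl⟩ := hb
      rw [Matrix.vecMulLinear_apply] at hbz
      obtain ⟨u, hu⟩ := exists_sub_smul_vecMul_mem_vec (h k rfl w (by
        refine Ideal.mem_vec_sup_span (u := v) ?_
        rw [← hbz, sub_add_cancel_left]
        exact Submodule.neg_mem _ hz))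
      have : v - u ᵥ* C.d k ∈ 𝔞.vec _ := by
        refine hx.mem_vec ?_
        rw [smul_sub, ← hbz, add_sub_right_comm]
        exact Submodule.add_mem _ hu hz
      rw [← add_sub_cancel (u ᵥ* C.d k) v]
      exact Submodule.add_mem_sup ⟨u, rfl⟩ this
  have pow : ∀ n, x ^ n • v ∈ C.coboundaries i ⊔ 𝔞.vec _ → v ∈ C.coboundaries i ⊔ 𝔞.vec _ := by
    intro n
    induction n with
    | zero => simp
    | succ n ih =>
      intro h
      rw [pow_succ', mul_smul] at h
      exact ih (inj _ h)
  exact pow N (hC.smul_mem_coboundaries hN hv)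

/-- If `R ⧸ J` has finite length over a ring in which `rs` is a regular sequence, then
`Ext^i(R ⧸ J, R) = 0` for `i` less than the length of `rs`. -/
lemma IsResolution.coexactMod_bot (hC : C.IsResolution J) {rs : List R}
    (hrs : (⊥ : Ideal R).IsRegularSeqMod rs) {N : ℕ} (hN : ∀ r ∈ rs, r ^ N ∈ J) {i : ℕ}
    (hi : i < rs.length) : C.CoexactMod ⊥ i := by
  suffices h : ∀ k j, j + k = rs.length → ∀ i, i + j < rs.length →
      C.CoexactMod (Ideal.ofList (rs.take j)) i by
    simpa using h rs.length 0 (by simp) i (by simpa using hi)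
  intro k
  induction k with
  | zero => intro j hj i hij; omega
  | succ k ih =>
    intro j hj i hij
    have hjl : j < rs.length := by omega
    refine hC.coexactMod_of_sup_span (hrs.isRegularMod_getElem hjl) (hN _ (rs.getElem_mem hjl)) ?_
    rintro m rfl
    rw [← Ideal.ofList_take_succ rs j hjl]
    exact ih (j + 1) (by omega) m (by omega)

lemma CoexactMod.sup_span {i : ℕ} (h : C.CoexactMod 𝔞 i) (h' : C.CoexactMod 𝔞 (i + 1))
    (hx : 𝔞.IsRegularMod x) : C.CoexactMod (𝔞 ⊔ Ideal.span {x}) i := by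
  intro v hv
  obtain ⟨u, hu⟩ := Ideal.exists_sub_smul_mem_vec hv
  have h1 : u ᵥ* C.d (i + 1) ∈ 𝔞.vec _ := by
    refine hx.mem_vec ?_
    have := Ideal.vecMul_mem_vec (C.d (i + 1)) hu
    rw [Matrix.sub_vecMul, vecMul_vecMul, Matrix.smul_vecMul, zero_sub] at this
    exact (Submodule.neg_mem_iff _).1 this
  obtain ⟨_, ⟨w, rfl⟩, z, hz, rfl⟩ := Submodule.mem_sup.1 (h' u h1)
  obtain ⟨b, hb, z', hz', hbz⟩ := Submodule.mem_sup.1 (h (v - x • w) (by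
    rw [Matrix.sub_vecMul, Matrix.smul_vecMul]
    convert Submodule.add_mem _ hu (Submodule.smul_mem _ x hz) using 1
    rw [smul_add, Matrix.vecMulLinear_apply]
    abel))
  rw [← sub_add_cancel v (x • w), ← hbz, add_assoc]
  refine Submodule.add_mem_sup hb (Ideal.mem_vec_sup_span (u := w) ?_)
  rwa [add_sub_cancel_right]

/-- If `Ext^i(R ⧸ I, R ⧸ 𝔞)` vanishes for `i < q`, then `I` contains a sequence of length `q` which
is weakly regular on `R ⧸ 𝔞`. -/
lemma IsResolution.exists_isRegularSeqMod [IsNoetherianRing R] (hC : C.IsResolution I) (q : ℕ)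
    (h : ∀ i < q, C.CoexactMod 𝔞 i) :
    ∃ rs : List R, rs.length = q ∧ (∀ r ∈ rs, r ∈ I) ∧ 𝔞.IsRegularSeqMod rs := by
  induction q generalizing 𝔞 with
  | zero => exact ⟨[], rfl, by simp, trivial⟩
  | succ q ih =>
    obtain ⟨x, hxI, hx⟩ : ∃ x ∈ I, 𝔞.IsRegularMod x := by
      by_contra! hcon
      have hsub : (I : Set R) ⊆ ⋃ P ∈ associatedPrimes R (R ⧸ 𝔞), (P : Set R) := by
        rw [biUnion_associatedPrimes_eq_zero_divisors]
        intro x hx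
        have := hcon x hx
        rw [Ideal.IsRegularMod] at this
        push Not at this
        obtain ⟨a, ha, ha'⟩ := this
        refine ⟨Ideal.Quotient.mk 𝔞 a, by rwa [Ne, Ideal.Quotient.eq_zero_iff_mem], ?_⟩
        rw [Algebra.smul_def]
        exact Ideal.Quotient.eq_zero_iff_mem.2 ha
      obtain ⟨P, hP, hIP⟩ := (Ideal.subset_union_prime_finite
        (associatedPrimes.finite R (R ⧸ 𝔞)) (f := fun P => P) ⊤ ⊤
        fun P hP _ _ => IsAssociatedPrime.isPrime hP).1 hsub
      obtain ⟨hprime, y, hy⟩ := isAssociatedPrime_iff.1 (AssociatedPrimes.mem_iff.1 hP)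
      obtain ⟨a, rfl⟩ := Ideal.Quotient.mk_surjective y
      have ha : (fun _ => a : C.ι 0 → R) ᵥ* C.d 0 ∈ 𝔞.vec _ := by
        intro b
        have hb : C.d 0 default b ∈ P := hIP ((hC.mem_iff _).2 ⟨Pi.single b 1, by simp⟩)
        rw [hy, Submodule.mem_colon_singleton, Algebra.smul_def] at hb
        have hb' : C.d 0 default b * a ∈ 𝔞 := Ideal.Quotient.eq_zero_iff_mem.1 hb
        rw [Matrix.vecMul, dotProduct, Fintype.sum_unique, mul_comm]
        exact hb'
      have ha' := h 0 (by omega) _ ha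
      rw [coboundaries, bot_sup_eq] at ha'
      refine hprime.ne_top ((Ideal.eq_top_iff_one _).2 ?_)
      rw [hy, Submodule.mem_colon_singleton, one_smul]
      exact Ideal.Quotient.eq_zero_iff_mem.2 (ha' default)
    obtain ⟨rs, hlen, hmem, hreg⟩ := ih (𝔞 := 𝔞 ⊔ Ideal.span {x}) fun i hi =>
      (h i (by omega)).sup_span (h (i + 1) (by omega)) hx
    refine ⟨x :: rs, by simp [hlen], ?_, hx, hreg⟩
    simpa using ⟨hxI, hmem⟩

/-- A multiplication which is null-homotopic on an initial segment of the dual of a resolution of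
`R ⧸ I` is multiplication by an element of `I`, provided the dual is exact there. -/
lemma IsResolution.mem_of_homotopy (hC : C.IsResolution I) {f : R} (i : ℕ)
    (h : ∀ j ≤ i, C.CoexactMod ⊥ j) (t : Matrix (C.ι (i + 1)) (C.ι i) R)
    (ht : C.d i * (t * C.d i) = f • C.d i) : f ∈ I := by
  have key : ∀ i, C.CoexactMod ⊥ i → ∀ t : Matrix (C.ι (i + 1)) (C.ι i) R,
      C.d i * (t * C.d i) = f • C.d i → ∀ e,
        (f • (1 : Matrix _ _ R) - C.d i * t).row e ∈ C.coboundaries i := by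
    intro i hi t ht e
    have h0 : (f • (1 : Matrix _ _ R) - C.d i * t) * C.d i = 0 := by
      rw [Matrix.sub_mul, Matrix.mul_assoc, ht, Matrix.smul_mul, Matrix.one_mul, sub_self]
    have := hi ((f • (1 : Matrix _ _ R) - C.d i * t).row e) (by
      rw [Ideal.vec_bot, Submodule.mem_bot]
      funext b
      exact congrFun (congrFun h0 e) b)
    simpa using this
  induction i with
  | zero =>
    have := congrFun ((Submodule.mem_bot R).1 (key 0 (h 0 le_rfl) t ht default)) default
    refine (hC.mem_iff f).2 ⟨t.col default, ?_⟩
    have h1 : f - (C.d 0 * t) default default = 0 := by simpa using this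
    exact (sub_eq_zero.1 h1).symm
  | succ i ih =>
    choose t' ht' using key (i + 1) (h _ le_rfl) t ht
    have h1 : Matrix.of t' * C.d i = f • (1 : Matrix _ _ R) - C.d (i + 1) * t := by
      ext e b
      exact congrFun (ht' e) b
    refine ih (fun j hj => h j (by omega)) (Matrix.of t') ?_
    rw [h1, Matrix.mul_sub, ← Matrix.mul_assoc, C.d_mul_d, Matrix.zero_mul, sub_zero,
      Matrix.mul_smul, Matrix.mul_one]

/-! ### Mapping cones -/

/-- The index types of the mapping cone of a multiplication. -/
def coneι (C : BasedComplex R) : ℕ → Type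
  | 0 => C.ι 0
  | i + 1 => C.ι (i + 1) ⊕ C.ι i

instance (C : BasedComplex R) : ∀ i, Fintype (C.coneι i)
  | 0 => inferInstanceAs (Fintype (C.ι 0))
  | i + 1 => inferInstanceAs (Fintype (C.ι (i + 1) ⊕ C.ι i))

instance (C : BasedComplex R) : ∀ i, DecidableEq (C.coneι i)
  | 0 => inferInstanceAs (DecidableEq (C.ι 0))
  | i + 1 => inferInstanceAs (DecidableEq (C.ι (i + 1) ⊕ C.ι i))

instance (C : BasedComplex R) : Unique (C.coneι 0) := inferInstanceAs (Unique (C.ι 0))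

/-- The differentials of the mapping cone of multiplication by `y`. -/
def coneD (C : BasedComplex R) (y : R) : ∀ i, Matrix (C.coneι i) (C.coneι (i + 1)) R
  | 0 => Matrix.fromCols (C.d 0) (y • (1 : Matrix (C.ι 0) (C.ι 0) R))
  | i + 1 => Matrix.fromBlocks (C.d (i + 1)) (y • (1 : Matrix (C.ι (i + 1)) (C.ι (i + 1)) R)) 0
      (-C.d i)

/-- A vector in a positive degree of the mapping cone, given by its two components. -/
def coneVec {i : ℕ} (a : C.ι (i + 1) → R) (b : C.ι i → R) : C.coneι (i + 1) → R :=
  Sum.elim a b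

lemma exists_eq_coneVec {i : ℕ} (v : C.coneι (i + 1) → R) :
    ∃ (a : C.ι (i + 1) → R) (b : C.ι i → R), v = coneVec a b :=
  ⟨fun e => v (Sum.inl e), fun e => v (Sum.inr e), (Sum.elim_comp_inl_inr v).symm⟩

lemma coneVec_inj {i : ℕ} {a a' : C.ι (i + 1) → R} {b b' : C.ι i → R} :
    coneVec a b = coneVec a' b' ↔ a = a' ∧ b = b' :=
  Sum.elim_eq_iff

lemma coneVec_zero {i : ℕ} : coneVec (0 : C.ι (i + 1) → R) (0 : C.ι i → R) = 0 :=
  Sum.elim_zero_zero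

lemma coneD_zero_mulVec (y : R) (a : C.ι 1 → R) (b : C.ι 0 → R) :
    C.coneD y 0 *ᵥ coneVec a b = (C.d 0 *ᵥ a + y • b : C.ι 0 → R) := by
  refine (Matrix.fromCols_mulVec (C.d 0) (y • (1 : Matrix (C.ι 0) (C.ι 0) R)) _).trans ?_
  rw [Matrix.smul_mulVec, Matrix.one_mulVec]
  rfl

lemma coneD_succ_mulVec (y : R) (i : ℕ) (a : C.ι (i + 2) → R) (b : C.ι (i + 1) → R) :
    C.coneD y (i + 1) *ᵥ coneVec a b = coneVec (C.d (i + 1) *ᵥ a + y • b) (-(C.d i *ᵥ b)) := by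
  refine (Matrix.fromBlocks_mulVec (C.d (i + 1))
    (y • (1 : Matrix (C.ι (i + 1)) (C.ι (i + 1)) R)) 0 (-C.d i) _).trans ?_
  rw [Matrix.smul_mulVec, Matrix.one_mulVec, Matrix.zero_mulVec, zero_add, Matrix.neg_mulVec]
  rfl

lemma vecMul_coneD_zero (y : R) (a : C.ι 0 → R) :
    (a : C.coneι 0 → R) ᵥ* C.coneD y 0 = coneVec (a ᵥ* C.d 0) (y • a) := by
  refine (Matrix.vecMul_fromCols (C.d 0) (y • (1 : Matrix (C.ι 0) (C.ι 0) R)) a).trans ?_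
  rw [Matrix.vecMul_smul, Matrix.vecMul_one]
  rfl

lemma vecMul_coneD_succ (y : R) (i : ℕ) (a : C.ι (i + 1) → R) (b : C.ι i → R) :
    coneVec a b ᵥ* C.coneD y (i + 1) = coneVec (a ᵥ* C.d (i + 1)) (y • a - b ᵥ* C.d i) := by
  refine (Matrix.vecMul_fromBlocks (C.d (i + 1))
    (y • (1 : Matrix (C.ι (i + 1)) (C.ι (i + 1)) R)) 0 (-C.d i) _).trans ?_
  rw [Matrix.vecMul_zero, add_zero, Matrix.vecMul_smul, Matrix.vecMul_one, Matrix.vecMul_neg,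
    ← sub_eq_add_neg]
  rfl

/-- The mapping cone of multiplication by `y` on a complex. -/
def cone (C : BasedComplex R) (y : R) : BasedComplex R where
  ι := C.coneι
  d := C.coneD y
  d_mul_d i := by
    cases i with
    | zero =>
      refine (Matrix.fromCols_mul_fromBlocks (C.d 0) (y • (1 : Matrix (C.ι 0) (C.ι 0) R)) (C.d 1)
        (y • (1 : Matrix (C.ι 1) (C.ι 1) R)) 0 (-C.d 0)).trans ?_
      rw [C.d_mul_d]
      simp
      rfl
    | succ i =>
      refine (Matrix.fromBlocks_multiply (C.d (i + 1))
        (y • (1 : Matrix (C.ι (i + 1)) (C.ι (i + 1)) R)) 0 (-C.d i) (C.d (i + 2))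
        (y • (1 : Matrix (C.ι (i + 2)) (C.ι (i + 2)) R)) 0 (-C.d (i + 1))).trans ?_
      simp [C.d_mul_d]
      rfl

lemma IsMinimal.cone {𝔪 : Ideal R} (hC : C.IsMinimal 𝔪) {y : R} (hy : y ∈ 𝔪) :
    (C.cone y).IsMinimal 𝔪 := by
  have hone : ∀ i (a b : C.ι i), (y • (1 : Matrix (C.ι i) (C.ι i) R)) a b ∈ 𝔪 := by
    intro i a b
    rw [Matrix.smul_apply, smul_eq_mul]
    exact 𝔪.mul_mem_right _ hy
  intro i
  cases i with
  | zero =>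
    rintro a (b | b)
    · exact hC 0 a b
    · exact hone 0 a b
  | succ i =>
    rintro (a | a) (b | b)
    · exact hC (i + 1) a b
    · exact hone (i + 1) a b
    · exact 𝔪.zero_mem
    · exact 𝔪.neg_mem (hC i a b)

/-- The mapping cone of an element `y` which is regular on `R ⧸ I` resolves `R ⧸ (I + (y))`. -/
lemma IsResolution.cone (hC : C.IsResolution I) {y : R} (hy : I.IsRegularMod y) :
    (C.cone y).IsResolution (I ⊔ Ideal.span {y}) where
  exact i v hv := by
    obtain ⟨a, b, rfl⟩ := exists_eq_coneVec v
    -- it suffices to treat the second component: a preimage `w` of `b` determines the first one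
    suffices h : C.d i *ᵥ a + y • b = 0 ∧ ∃ w, C.d i *ᵥ w = b by
      obtain ⟨h1, w, rfl⟩ := h
      obtain ⟨u, hu⟩ := hC.exact i (a + y • w) (by rw [Matrix.mulVec_add, Matrix.mulVec_smul, h1])
      refine ⟨coneVec u (-w), (coneD_succ_mulVec y i _ _).trans ?_⟩
      rw [hu, Matrix.mulVec_neg, smul_neg, neg_neg, add_neg_cancel_right]
    cases i with
    | zero =>
      have h1 := (coneD_zero_mulVec y a b).symm.trans hv
      refine ⟨h1, hC.exists_mulVec_zero_eq (hy _ ((hC.mem_iff _).2 ⟨-a, ?_⟩))⟩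
      rw [Matrix.mulVec_neg]
      exact (congrFun (eq_neg_of_add_eq_zero_right h1) default).symm
    | succ i =>
      have h0 := ((coneD_succ_mulVec y i a b).symm.trans hv).trans coneVec_zero.symm
      obtain ⟨h1, h2⟩ := coneVec_inj.1 h0
      exact ⟨h1, hC.exact i _ (neg_eq_zero.1 h2)⟩
  mem_iff x := by
    rw [Submodule.mem_sup]
    constructor
    · rintro ⟨a, ha, z, hz, rfl⟩
      obtain ⟨w, rfl⟩ := (hC.mem_iff _).1 ha
      obtain ⟨t, rfl⟩ := Ideal.mem_span_singleton'.1 hz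
      refine ⟨coneVec w fun _ => t, (congrFun (coneD_zero_mulVec y w fun _ => t) _).trans ?_⟩
      rw [mul_comm t]
      rfl
    · rintro ⟨w, rfl⟩
      obtain ⟨a, b, rfl⟩ := exists_eq_coneVec w
      exact ⟨_, (hC.mem_iff _).2 ⟨a, rfl⟩, _, Ideal.mul_mem_right _ _
        (Ideal.mem_span_singleton_self y), (congrFun (coneD_zero_mulVec y a b) _).symm⟩

/-- If `Ext^(i+1)(R ⧸ (I + (y)), R)` vanishes, then multiplication by `y` is surjective on
`Ext^i(R ⧸ I, R)`, which is therefore zero by Nakayama's lemma. -/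
lemma CoexactMod.of_cone [IsNoetherianRing R] {y : R} (hy : y ∈ (⊥ : Ideal R).jacobson) {i : ℕ}
    (h : (C.cone y).CoexactMod ⊥ (i + 1)) : C.CoexactMod ⊥ i := by
  have key : ∀ v : C.ι i → R, v ᵥ* C.d i = 0 → ∃ u, u ᵥ* C.d i = 0 ∧
      v - y • u ∈ C.coboundaries i := by
    intro v hv
    have h1 := h (coneVec 0 v) (by
      rw [Ideal.vec_bot, Submodule.mem_bot]
      refine (vecMul_coneD_succ y i 0 v).trans ?_
      rw [hv, Matrix.zero_vecMul, smul_zero, sub_zero]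
      exact coneVec_zero)
    rw [Ideal.vec_bot, sup_bot_eq] at h1
    obtain ⟨w, hw⟩ := h1
    cases i with
    | zero =>
      obtain ⟨h2, rfl⟩ := coneVec_inj.1 ((vecMul_coneD_zero (C := C) y w).symm.trans hw)
      exact ⟨w, h2, by rw [sub_self]; exact Submodule.zero_mem _⟩
    | succ i =>
      obtain ⟨a, b, rfl⟩ := exists_eq_coneVec w
      obtain ⟨h2, rfl⟩ := coneVec_inj.1 ((vecMul_coneD_succ y i a b).symm.trans hw)
      refine ⟨a, h2, -b, ?_⟩
      rw [sub_sub_cancel_left, Matrix.vecMulLinear_apply, Matrix.neg_vecMul]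
  have hle : LinearMap.ker (C.d i).vecMulLinear ≤ C.coboundaries i := by
    refine Submodule.le_of_le_smul_of_le_jacobson_bot (I := Ideal.span {y})
      (IsNoetherian.noetherian _) ((Ideal.span_singleton_le_iff_mem _).2 hy) ?_
    intro v hv
    obtain ⟨u, hu, hvu⟩ := key v hv
    rw [← sub_add_cancel v (y • u)]
    exact Submodule.add_mem_sup hvu
      (Submodule.smul_mem_smul (Ideal.mem_span_singleton_self y) hu)
  intro v hv
  rw [Ideal.vec_bot, Submodule.mem_bot] at hv
  exact Submodule.mem_sup_left (hle hv)

/-- Iterated mapping cones: from a minimal resolution of `R ⧸ I` one obtains a minimal resolution of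
`R ⧸ (I + (y₁, …, y_d))` when the `yₖ` form a regular sequence on `R ⧸ I`. The last nonzero term and
the vanishing of the cohomology of the dual complex are shifted by `d`. -/
lemma IsResolution.exists_iterated_cone [IsLocalRing R] [IsNoetherianRing R] (ys : List R)
    (hys : ∀ y ∈ ys, y ∈ IsLocalRing.maximalIdeal R) (hC : C.IsResolution I)
    (hmin : C.IsMinimal (IsLocalRing.maximalIdeal R)) (hreg : I.IsRegularSeqMod ys) :
    ∃ G : BasedComplex R, G.IsResolution (I ⊔ Ideal.ofList ys) ∧
      G.IsMinimal (IsLocalRing.maximalIdeal R) ∧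
      (∀ i, IsEmpty (G.ι (i + ys.length)) → IsEmpty (C.ι i)) ∧
      (∀ i, (∀ j, i < j → IsEmpty (C.ι j)) →
        Fintype.card (G.ι (i + ys.length)) = Fintype.card (C.ι i)) ∧
      ∀ i, G.CoexactMod ⊥ (i + ys.length) → C.CoexactMod ⊥ i := by
  induction ys generalizing C I with
  | nil => exact ⟨C, by simpa using hC, hmin, fun _ h => h, fun _ _ => rfl, fun _ h => h⟩
  | cons y ys ih =>
    have hy : y ∈ IsLocalRing.maximalIdeal R := hys y (by simp)
    obtain ⟨G, h1, h2, h3, h4, h5⟩ := ih (fun z hz => hys z (by simp [hz])) (hC.cone hreg.1)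
      (hmin.cone hy) hreg.2
    have hshift : ∀ i, i + (y :: ys).length = i + 1 + ys.length := fun i => by
      rw [List.length_cons]; omega
    refine ⟨G, by rwa [Ideal.ofList_cons, ← sup_assoc], h2, fun i h => ?_, fun i h => ?_,
      fun i h => ?_⟩
    · rw [hshift] at h
      exact ⟨fun e => (h3 (i + 1) h).elim (Sum.inr e)⟩
    · rw [hshift, h4 (i + 1)]
      · have : Fintype.card (C.ι (i + 1)) = 0 := Fintype.card_eq_zero_iff.2 (h (i + 1) (by omega))
        refine (Fintype.card_sum (α := C.ι (i + 1)) (β := C.ι i)).trans ?_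
        rw [this, zero_add]
      · intro j hj
        obtain ⟨j, rfl⟩ : ∃ k, j = k + 1 := ⟨j - 1, by omega⟩
        have := h (j + 1) (by omega)
        have := h j (by omega)
        exact inferInstanceAs (IsEmpty (C.ι (j + 1) ⊕ C.ι j))
    · rw [hshift] at h
      exact (h5 (i + 1) h).of_cone (by rwa [IsLocalRing.jacobson_eq_maximalIdeal _ bot_ne_top])

end BasedComplex

/-! ### Heights and regular sequences -/

namespace Ideal

variable {R : Type u} [CommRing R]

lemma IsRegularMod.height_add_one_le {𝔞 : Ideal R} {x : R} (hx : 𝔞.IsRegularMod x) :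
    𝔞.height + 1 ≤ (𝔞 ⊔ span {x}).height := by
  rw [height_eq_inf_minimalPrimes (𝔞 ⊔ span {x})]
  refine le_iInf₂ fun P hP => ?_
  have := hP.isPrime
  obtain ⟨Q, hQ, hQP⟩ := exists_minimalPrimes_le (le_sup_left.trans hP.le)
  have := hQ.isPrime
  have hxQ : x ∉ Q := fun h => by
    obtain ⟨y, hy, hxy⟩ := exists_mul_mem_of_mem_minimalPrimes hQ h
    exact hy (hx y hxy)
  have hlt : Q < P := lt_of_le_of_ne hQP fun h => hxQ
    (h ▸ hP.le (le_sup_right (a := 𝔞) (mem_span_singleton_self x)))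
  exact (add_le_add_left (height_mono hQ.le) 1).trans (height_add_one_le_of_lt_of_isPrime hlt)

lemma IsRegularSeqMod.height_add_length_le {𝔞 : Ideal R} {rs : List R}
    (hrs : 𝔞.IsRegularSeqMod rs) : 𝔞.height + rs.length ≤ (𝔞 ⊔ ofList rs).height := by
  induction rs generalizing 𝔞 with
  | nil => simp
  | cons r rs ih =>
    rw [ofList_cons, ← sup_assoc]
    refine le_trans ?_ (ih hrs.2)
    rw [List.length_cons, Nat.cast_add, Nat.cast_one, add_comm (rs.length : ℕ∞), ← add_assoc]
    exact add_le_add_left hrs.1.height_add_one_le _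

lemma spanFinrank_ofList_le (rs : List R) : (ofList rs).spanFinrank ≤ rs.length := by
  classical
  have h : {r | r ∈ rs} = (rs.toFinset : Set R) := by ext; simp
  rw [ofList, h]
  refine (Submodule.spanFinrank_span_le_ncard_of_finite (Finset.finite_toSet _)).trans ?_
  rw [Set.ncard_coe_finset]
  exact List.toFinset_card_le rs

lemma exists_ofList_eq_of_fg {𝔞 : Ideal R} (h : 𝔞.FG) :
    ∃ rs : List R, ofList rs = 𝔞 ∧ rs.length = 𝔞.spanFinrank := by
  refine ⟨(Submodule.FG.finite_generators h).toFinset.toList, ?_, ?_⟩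
  · simp only [ofList, Finset.mem_toList, Set.Finite.mem_toFinset, Set.ofPred_mem_eq]
    exact 𝔞.span_generators
  · rw [Finset.length_toList, ← Submodule.FG.generators_ncard h,
      Set.ncard_eq_toFinset_card _ (Submodule.FG.finite_generators h)]

end Ideal

/-! ### Regular local rings -/

namespace IsRegularLocalRing

open IsLocalRing

/-- The quotient of a regular local ring by a part of a minimal system of generators of the maximal
ideal is regular. -/
lemma quotient_ofList {R : Type u} [CommRing R] [IsRegularLocalRing R] {rs ts : List R}
    (h : Ideal.ofList rs ⊔ Ideal.ofList ts = maximalIdeal R)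
    (hlen : rs.length + ts.length ≤ (maximalIdeal R).spanFinrank) :
    ∃ _ : IsRegularLocalRing (R ⧸ Ideal.ofList rs),
      (maximalIdeal (R ⧸ Ideal.ofList rs)).spanFinrank ≤ ts.length := by
  have hK : Ideal.ofList rs ≤ maximalIdeal R := le_sup_left.trans h.le
  have : Nontrivial (R ⧸ Ideal.ofList rs) := Ideal.Quotient.nontrivial_iff.2 fun h' =>
    (maximalIdeal.isMaximal R).ne_top (top_le_iff.1 (h' ▸ hK))
  have : IsLocalRing (R ⧸ Ideal.ofList rs) := .of_surjective' _ Ideal.Quotient.mk_surjective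
  have hmax : maximalIdeal (R ⧸ Ideal.ofList rs) =
      Ideal.ofList (ts.map (Ideal.Quotient.mk (Ideal.ofList rs))) := by
    rw [← map_maximalIdeal_of_surjective (Ideal.Quotient.mk (Ideal.ofList rs))
      Ideal.Quotient.mk_surjective, ← h, Ideal.map_sup, Ideal.map_quotient_self, bot_sup_eq,
      Ideal.map_ofList]
  have hle : (maximalIdeal (R ⧸ Ideal.ofList rs)).spanFinrank ≤ ts.length := by
    rw [hmax, ← List.length_map (as := ts) (Ideal.Quotient.mk (Ideal.ofList rs))]
    exact Ideal.spanFinrank_ofList_le _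
  refine ⟨of_spanFinrank_maximalIdeal_le _ (le_trans (Nat.cast_le.2 hle) ?_), hle⟩
  have hdim := ringKrullDim_le_ringKrullDim_quotient_add_spanFinrank
    (I := Ideal.ofList rs) (by rwa [ringJacobson_eq_maximalIdeal])
  rw [← spanFinrank_maximalIdeal] at hdim
  have hd : ((ts.length + rs.length : ℕ) : WithBot ℕ∞) ≤
      ringKrullDim (R ⧸ Ideal.ofList rs) + rs.length :=
    (Nat.cast_le.2 (by omega)).trans (hdim.trans (add_le_add_right
      (Nat.cast_le.2 (Ideal.spanFinrank_ofList_le rs)) _))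
  obtain ⟨d, hd'⟩ := WithBot.ne_bot_iff_exists.1
    (ringKrullDim_ne_bot (R := R ⧸ Ideal.ofList rs))
  rw [← hd'] at hd ⊢
  have hd2 : ((ts.length + rs.length : ℕ) : ℕ∞) ≤ d + rs.length := by exact_mod_cast hd
  rw [Nat.cast_add] at hd2
  exact_mod_cast (ENat.add_le_add_iff_right (ENat.natCast_ne_top _)).1 hd2

/-- Exchange: an element of the maximal ideal outside its square can replace one of the elements in
a system of generators. -/
lemma exists_ofList_sup_eq {R : Type u} [CommRing R] [IsLocalRing R] {rs : List R}
    (h : Ideal.ofList rs = maximalIdeal R) {x : R} (hx : x ∈ maximalIdeal R)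
    (hx2 : x ∉ maximalIdeal R ^ 2) : ∃ ts : List R, ts.length + 1 = rs.length ∧
      Ideal.ofList [x] ⊔ Ideal.ofList ts = maximalIdeal R := by
  have hrange : Ideal.ofList rs = Ideal.span (Set.range fun i : Fin rs.length => rs[i]) := by
    have hset : {r | r ∈ rs} = Set.range fun i : Fin rs.length => rs[i] := by
      ext r
      simp [List.mem_iff_getElem, Fin.exists_iff]
    rw [Ideal.ofList, hset]
  have hmem : ∀ i : Fin rs.length, rs[i] ∈ maximalIdeal R := fun i =>
    h ▸ Ideal.subset_span (rs.getElem_mem i.2)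
  obtain ⟨a, ha⟩ := Ideal.mem_span_range_iff_exists_fun.1 (hrange ▸ h.ge hx)
  obtain ⟨i, hi⟩ : ∃ i, a i ∉ maximalIdeal R := by
    by_contra! hcon
    refine hx2 ?_
    rw [← ha, pow_two]
    exact Ideal.sum_mem _ fun i _ => Ideal.mul_mem_mul (hcon i) (hmem i)
  refine ⟨rs.eraseIdx i, List.length_eraseIdx_add_one i.2, le_antisymm (sup_le ?_ ?_) ?_⟩
  · simpa using hx
  · refine Ideal.span_le.2 fun r hr => ?_
    exact h ▸ Ideal.subset_span (List.mem_of_mem_eraseIdx hr)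
  · rw [← h, hrange]
    refine Ideal.span_le.2 ?_
    have hj : ∀ j, j ≠ i → rs[j] ∈ Ideal.ofList [x] ⊔ Ideal.ofList (rs.eraseIdx i) := fun j hj =>
      le_sup_right (a := Ideal.ofList [x]) (Ideal.subset_span
        (List.mem_eraseIdx_iff_getElem.2 ⟨j, j.2, fun h => hj (Fin.ext h), rfl⟩))
    rintro _ ⟨j, rfl⟩
    by_cases hji : j = i
    · subst hji
      have hunit : IsUnit (a j) := by simpa using hi
      refine (Ideal.unit_mul_mem_iff_mem _ hunit).1 ?_
      rw [← Finset.add_sum_erase _ _ (Finset.mem_univ j), ← eq_sub_iff_add_eq] at ha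
      dsimp only
      rw [ha]
      refine Ideal.sub_mem _ (le_sup_left (b := Ideal.ofList (rs.eraseIdx j))
        (Ideal.subset_span (by simp))) ?_
      exact Ideal.sum_mem _ fun k hk => Ideal.mul_mem_left _ _ (hj k (Finset.ne_of_mem_erase hk))
    · exact hj j hji

/-- A regular local ring is a domain. By induction on the dimension, dividing by an element of
`𝔪 \ 𝔪 ^ 2` outside all minimal primes gives a domain, so this element generates a prime ideal; a
minimal prime inside it vanishes by Nakayama's lemma. -/
theorem isDomain (R : Type u) [CommRing R] [IsRegularLocalRing R] : IsDomain R := by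
  suffices h : ∀ (n : ℕ) (R : Type u) [CommRing R] [IsRegularLocalRing R],
      (maximalIdeal R).spanFinrank ≤ n → IsDomain R from h _ R le_rfl
  intro n
  induction n with
  | zero =>
    intro R _ _ hn
    obtain ⟨rs, hrs, hlen⟩ := Ideal.exists_ofList_eq_of_fg
      (IsNoetherian.noetherian (maximalIdeal R))
    obtain rfl : rs = [] := List.length_eq_zero_iff.1 (by omega)
    exact (isField_iff_maximalIdeal_eq.2 (hrs.symm.trans Ideal.ofList_nil)).isDomain
  | succ n ih =>
    intro R _ _ hn
    obtain ⟨rs, hrs, hlen⟩ := Ideal.exists_ofList_eq_of_fg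
      (IsNoetherian.noetherian (maximalIdeal R))
    by_cases hmin : maximalIdeal R ∈ minimalPrimes R
    · refine ih R ?_
      have h0 : (maximalIdeal R).height = 0 := Ideal.height_eq_zero_iff.2 hmin
      have := spanFinrank_maximalIdeal (R := R)
      rw [← maximalIdeal_height_eq_ringKrullDim, h0] at this
      have : (maximalIdeal R).spanFinrank = 0 := by exact_mod_cast this
      omega
    by_cases hsq : maximalIdeal R ≤ maximalIdeal R ^ 2
    · have h0 : maximalIdeal R = ⊥ := Submodule.eq_bot_of_le_smul_of_le_jacobson_bot
        (maximalIdeal R) _ (IsNoetherian.noetherian _) (by rwa [smul_eq_mul, ← pow_two])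
        (maximalIdeal_le_jacobson _)
      exact (isField_iff_maximalIdeal_eq.2 h0).isDomain
    obtain ⟨x, hx, hx2, hxmin⟩ : ∃ x ∈ maximalIdeal R, x ∉ maximalIdeal R ^ 2 ∧
        ∀ P ∈ minimalPrimes R, x ∉ P := by
      by_contra! hcon
      obtain ⟨P, hP, hle⟩ := (Ideal.subset_union_prime_finite
        ((minimalPrimes.finite_of_isNoetherianRing R).insert (maximalIdeal R ^ 2))
        (I := maximalIdeal R) (f := fun P => P) (maximalIdeal R ^ 2) (maximalIdeal R ^ 2) (by
          intro P hP hne _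
          exact (hP.resolve_left hne).isPrime)).1 (by
            intro x hx
            by_cases hx2 : x ∈ maximalIdeal R ^ 2
            · exact Set.mem_biUnion (Set.mem_insert _ _) hx2
            · obtain ⟨P, hP, hxP⟩ := hcon x hx hx2
              exact Set.mem_biUnion (Set.mem_insert_of_mem _ hP) hxP)
      rcases hP with rfl | hP
      · exact hsq hle
      · have := hP.isPrime
        exact hmin (((maximalIdeal.isMaximal R).eq_of_le this.ne_top hle) ▸ hP)
    obtain ⟨ts, hts, hsup⟩ := exists_ofList_sup_eq hrs hx hx2
    obtain ⟨hreg, hfin⟩ := quotient_ofList hsup (by simp only [List.length_singleton]; omega)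
    have hdom := ih (R ⧸ Ideal.ofList [x]) (by omega)
    have hprime : (Ideal.ofList [x]).IsPrime := (Ideal.Quotient.isDomain_iff_prime _).1 hdom
    obtain ⟨P, hP, hPx⟩ := Ideal.exists_minimalPrimes_le (bot_le (a := Ideal.ofList [x]))
    have hPprime := hP.isPrime
    have hP0 : P = ⊥ := by
      refine Submodule.eq_bot_of_le_smul_of_le_jacobson_bot (maximalIdeal R) _
        (IsNoetherian.noetherian _) (fun y hy => ?_) (maximalIdeal_le_jacobson _)
      have hyx := hPx hy
      rw [Ideal.ofList_singleton] at hyx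
      obtain ⟨q, rfl⟩ := Ideal.mem_span_singleton.1 hyx
      exact Submodule.smul_mem_smul hx ((hPprime.mem_or_mem hy).resolve_left (hxmin P hP))
    rw [hP0] at hPprime
    exact IsDomain.of_bot_isPrime R

/-- Every minimal system of generators of the maximal ideal of a regular local ring is a regular
sequence. -/
theorem isRegularSeqMod {R : Type u} [CommRing R] [IsRegularLocalRing R] {rs : List R}
    (h : Ideal.ofList rs = maximalIdeal R) (hlen : rs.length = (maximalIdeal R).spanFinrank) :
    (⊥ : Ideal R).IsRegularSeqMod rs := by
  refine (Ideal.isRegularSeqMod_iff _ _).2 fun i hi => ?_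
  rw [bot_sup_eq]
  obtain ⟨hreg, -⟩ := quotient_ofList (rs := rs.take i) (ts := rs.drop i)
    (by rw [← Ideal.ofList_append, List.take_append_drop, h])
    (by rw [List.length_take, List.length_drop]; omega)
  have hprime : (Ideal.ofList (rs.take i)).IsPrime :=
    (Ideal.Quotient.isDomain_iff_prime _).1 (isDomain _)
  have hnot : rs[i] ∉ Ideal.ofList (rs.take i) := by
    intro hmem
    have h1 : Ideal.ofList (rs.take i ++ rs.drop (i + 1)) = maximalIdeal R := by
      rw [← h]
      nth_rewrite 3 [← List.take_append_drop (i + 1) rs]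
      rw [Ideal.ofList_append, Ideal.ofList_append, Ideal.ofList_take_succ rs i hi,
        sup_eq_left.2 ((Ideal.span_singleton_le_iff_mem _).2 hmem)]
    have h2 := Ideal.spanFinrank_ofList_le (rs.take i ++ rs.drop (i + 1))
    rw [h1, List.length_append, List.length_take, List.length_drop] at h2
    omega
  exact fun a ha => (hprime.mem_or_mem ha).resolve_left hnot

end IsRegularLocalRing

/-! ### Resolutions of Gorenstein quotients of regular local rings -/

section Gorenstein

variable {R : Type u} [CommRing R] {I : Ideal R}

open IsLocalRing

lemma InfIrred.comap_of_surjective {A : Type v} [CommRing A] {π : R →+* A}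
    (hπ : Function.Surjective π) {K : Ideal A} (hK : InfIrred K) : InfIrred (K.comap π) := by
  have hinj := Ideal.comap_injective_of_surjective π hπ
  refine ⟨fun h => hK.1 ?_, fun b c hbc => ?_⟩
  · rw [isMax_iff_eq_top] at h ⊢
    exact hinj (h.trans (Ideal.comap_top (f := π)).symm)
  · have hcm : ∀ b, K.comap π ≤ b → (b.map π).comap π = b := fun b hb => by
      rw [Ideal.comap_map_of_surjective π hπ, sup_eq_left]
      exact (Ideal.comap_mono bot_le).trans hb
    have hb := hcm b (hbc ▸ inf_le_left)
    have hc := hcm c (hbc ▸ inf_le_right)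
    have hinf : b.map π ⊓ c.map π = K := hinj (by rw [Ideal.comap_inf, hb, hc, hbc])
    refine (hK.2 hinf).imp (fun h => ?_) fun h => ?_
    · rw [← h, hb]
    · rw [← h, hc]

/-- A Gorenstein quotient `A` of a local ring, in terms of sequences in the ring itself. -/
lemma IsGorensteinLocalRing.exists_isRegularSeqMod [IsLocalRing R] [IsNoetherianRing R]
    {A : Type v} [CommRing A] {π : R →+* A} (hπ : Function.Surjective π) (hker : RingHom.ker π = I)
    (hA : IsGorensteinLocalRing A) : ∃ ys : List R, I.IsRegularSeqMod ys ∧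
      InfIrred (I ⊔ Ideal.ofList ys) ∧ ∃ N, maximalIdeal R ^ N ≤ I ⊔ Ideal.ofList ys := by
  obtain ⟨rs, hreg, hrad, hirr⟩ := hA.exists_irreducible_parameter_ideal
  obtain ⟨ys, rfl⟩ := List.map_surjective_iff.2 hπ rs
  have hcomap : ∀ ts : List R, (Ideal.ofList (ts.map π)).comap π = I ⊔ Ideal.ofList ts := by
    intro ts
    rw [← Ideal.map_ofList, Ideal.comap_map_of_surjective π hπ, sup_comm, ← hker]
    rfl
  refine ⟨ys, ?_⟩
  rw [← hcomap]
  refine ⟨(Ideal.isRegularSeqMod_iff _ _).2 fun i hi a ha => ?_, hirr.comap_of_surjective hπ,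
    ?_⟩
  · rw [← hcomap, List.map_take, Ideal.mem_comap] at ha ⊢
    have h := hreg.regular_mod_prev i (by simpa using hi)
    rw [List.getElem_map] at h
    rw [smul_eq_mul, Ideal.mul_top] at h
    have h1 := h (a₁ := Ideal.Quotient.mk _ (π a)) (a₂ := 0) (by
      change π ys[i] • _ = π ys[i] • _
      rw [smul_zero, Algebra.smul_def]
      rw [map_mul] at ha
      exact Ideal.Quotient.eq_zero_iff_mem.2 ha)
    exact Ideal.Quotient.eq_zero_iff_mem.1 h1
  · have hm : (maximalIdeal A).comap π = maximalIdeal R :=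
      eq_maximalIdeal (Ideal.comap_isMaximal_of_surjective π hπ)
    rw [← hrad, Ideal.comap_radical] at hm
    obtain ⟨N, hN⟩ := Ideal.exists_radical_pow_le_of_fg
      ((Ideal.ofList (ys.map π)).comap π) (IsNoetherian.noetherian _)
    exact ⟨N, by rwa [hm] at hN⟩

/-- The minimal resolution of a Gorenstein quotient of codimension `c` of a regular local ring has
length `c`, its last module has rank one, and the entries of its last matrix generate `I`. -/
theorem BasedComplex.IsResolution.gorenstein [IsRegularLocalRing R] {c : ℕ} (hI : I.height = c)
    {A : Type v} [CommRing A] {π : R →+* A} (hπ : Function.Surjective π)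
    (hker : RingHom.ker π = I) (hA : IsGorensteinLocalRing A) {C : BasedComplex R}
    (hC : C.IsResolution I) (hmin : C.IsMinimal (maximalIdeal R)) :
    Fintype.card (C.ι c) = 1 ∧ (∀ i, c < i → IsEmpty (C.ι i)) ∧
      ∀ k, k + 1 = c → Ideal.span {x : R | ∃ a b, C.d k a b = x} = I := by
  obtain ⟨rs, hrs, hlen⟩ := Ideal.exists_ofList_eq_of_fg
    (IsNoetherian.noetherian (maximalIdeal R))
  have hreg := IsRegularLocalRing.isRegularSeqMod hrs hlen
  have hdim : (maximalIdeal R).height = rs.length := by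
    have h := IsRegularLocalRing.spanFinrank_maximalIdeal (R := R)
    rw [← maximalIdeal_height_eq_ringKrullDim, ← hlen] at h
    exact_mod_cast h.symm
  obtain ⟨ys, hys, hirr, N, hN⟩ := hA.exists_isRegularSeqMod hπ hker
  have hJ : I ⊔ Ideal.ofList ys ≤ maximalIdeal R :=
    le_maximalIdeal fun h => hirr.1 (h ▸ isMax_top)
  obtain ⟨G, hG, hGmin, hG1, hG2, hG3⟩ := hC.exists_iterated_cone ys
    (fun y hy => hJ (le_sup_right (a := I) (Ideal.subset_span hy))) hmin hys
  have hle : c + ys.length ≤ rs.length := by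
    have := hys.height_add_length_le.trans (Ideal.height_mono hJ)
    rw [hI, hdim] at this
    exact_mod_cast this
  have hco : ∀ i, i + ys.length < rs.length → C.CoexactMod ⊥ i := fun i hi =>
    hG3 i (hG.coexactMod_bot hreg
      (fun r hr => hN (Ideal.pow_mem_pow (hrs ▸ Ideal.subset_span hr) N)) hi)
  have hge : rs.length ≤ c + ys.length := by
    obtain ⟨zs, hzlen, hzI, hz⟩ := hC.exists_isRegularSeqMod (𝔞 := ⊥) (rs.length - ys.length)
      fun i hi => hco i (by omega)
    have := hz.height_add_length_le.trans (Ideal.height_mono (I := ⊥ ⊔ Ideal.ofList zs) (J := I)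
      (by rw [bot_sup_eq]; exact Ideal.span_le.2 hzI))
    rw [hI, hzlen] at this
    have : rs.length - ys.length ≤ c := by exact_mod_cast le_add_self.trans this
    omega
  have hn : rs.length = c + ys.length := le_antisymm hge hle
  have hempty : ∀ i, c < i → IsEmpty (C.ι i) := fun i hi =>
    hG1 i (hG.isEmpty_of_length_lt hreg hrs hGmin (by omega))
  have hcard : Fintype.card (C.ι c) = 1 := by
    rw [← hG2 c hempty, ← hn]
    exact hG.card_length_eq_one hreg hrs hGmin hirr hN
  refine ⟨hcard, hempty, ?_⟩
  rintro k rfl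
  have hsub : Subsingleton (C.ι (k + 1)) := Fintype.card_le_one_iff_subsingleton.1 hcard.le
  refine le_antisymm (Ideal.span_le.2 ?_) fun f hf => ?_
  · rintro _ ⟨a, b, rfl⟩
    refine hC.mem_of_homotopy k (fun j hj => hco j (by omega)) (Matrix.of fun _ => Pi.single a 1) ?_
    have : (Matrix.of fun _ => Pi.single a 1 : Matrix (C.ι (k + 1)) (C.ι k) R) * C.d k =
        C.d k a b • (1 : Matrix _ _ R) := by
      ext e e'
      rw [Subsingleton.elim e b, Subsingleton.elim e' b, Matrix.smul_apply, Matrix.one_apply_eq,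
        Matrix.mul_apply', smul_eq_mul, mul_one]
      exact single_one_dotProduct _ _
    rw [this, Matrix.mul_smul, Matrix.mul_one]
  · obtain ⟨s, -, hs⟩ := hC.exists_homotopy hf
    obtain ⟨b⟩ := Fintype.card_pos_iff.1 (hcard ▸ Nat.one_pos)
    have hb := congrFun (congrFun (hs k) b) b
    have := hempty (k + 2) (by omega)
    rw [Matrix.add_apply, Matrix.mul_apply, Matrix.mul_apply, Fintype.sum_empty, zero_add,
      Matrix.smul_apply, Matrix.one_apply_eq, smul_eq_mul, mul_one] at hb
    rw [← hb]
    exact Ideal.sum_mem _ fun a _ => Ideal.mul_mem_left _ _ (Ideal.subset_span ⟨a, b, rfl⟩)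

end Gorenstein

/-! ### The socle multiplier of a Frobenius comparison -/

namespace FreeResolution

variable {R : Type u} [CommRing R] {I : Ideal R}

/-- A free resolution as a complex with bases indexed by finite types. -/
def toBasedComplex (F : FreeResolution I) : BasedComplex R where
  ι i := Fin (F.rank i)
  unique := ⟨⟨F.basisZero⟩, fun a => F.eq_of_fin_rank_zero a _⟩
  d := F.d
  d_mul_d := F.d_mul_d

lemma isResolution_toBasedComplex (F : FreeResolution I) : F.toBasedComplex.IsResolution I where
  exact _ _ hv := F.exists_mulVec_eq hv
  mem_iff x := by
    constructor
    · intro hx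
      obtain ⟨w, hw⟩ := F.exists_mulVec_zero_eq (v := fun _ => x) hx
      exact ⟨w, congrFun hw _⟩
    · rintro ⟨w, rfl⟩
      exact F.mulVec_zero_mem w _

/-- If the entries of the last matrix of the resolution generate `I`, then the last component of a
Frobenius comparison multiplies `I` into `𝔪` times the Frobenius power. -/
lemma FrobeniusComparison.span_mul_le {p : ℕ} (hp : p.Prime) [CharP R p] {𝔪 : Ideal R}
    {F : FreeResolution I} (hF : F.IsMinimal 𝔪) (α : F.FrobeniusComparison p) {k : ℕ} (hk : 1 ≤ k)
    (hI : Ideal.span {x : R | ∃ a b, F.d k a b = x} = I) {Δ : R} (hΔ : α.map (k + 1) = Δ • 1) :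
    Ideal.span {Δ} * I ≤ 𝔪 * frobeniusPower p I := by
  refine (Ideal.mul_mono_right hI.ge).trans ?_
  rw [Ideal.span_mul_span', Ideal.span_le]
  rintro _ ⟨_, rfl, _, ⟨a, b, rfl⟩, rfl⟩
  have h := congrFun (congrFun (α.comm k) a) b
  rw [hΔ, Matrix.mul_smul, Matrix.mul_one, Matrix.smul_apply, smul_eq_mul, Matrix.mul_apply] at h
  dsimp only
  rw [SetLike.mem_coe, h]
  refine Ideal.sum_mem _ fun x _ => Ideal.mul_mem_mul (α.map_mem hp hF hk a x) ?_
  exact Ideal.subset_span ⟨F.d k x b, hI.le (Ideal.subset_span ⟨x, b, rfl⟩), rfl⟩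

end FreeResolution

/-! ### Localization -/

section LocalizationMatrix

variable {R : Type u} [CommRing R] {l m n : Type*} [Fintype m]

lemma map_algebraMap_mulVec (S : Type v) [CommRing S] [Algebra R S] (A : Matrix l m R)
    (v : m → R) :
    A.map (algebraMap R S) *ᵥ (algebraMap R S ∘ v) = algebraMap R S ∘ (A *ᵥ v) :=
  funext fun a => (RingHom.map_mulVec (algebraMap R S) A v a).symm

/-- Localization preserves the exactness of a pair of matrices. -/
lemma exists_map_mulVec_eq_of_isLocalization [Fintype l] [Fintype n] (M : Submonoid R)
    (S : Type v) [CommRing S] [Algebra R S] [IsLocalization M S] {A : Matrix l m R}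
    {B : Matrix m n R} (h : ∀ v, A *ᵥ v = 0 → ∃ w, B *ᵥ w = v) {v : m → S}
    (hv : A.map (algebraMap R S) *ᵥ v = 0) : ∃ w, B.map (algebraMap R S) *ᵥ w = v := by
  obtain ⟨b, hb⟩ := IsLocalization.exist_integer_multiples_of_finite M v
  choose w hw using hb
  have hw' : algebraMap R S ∘ w = algebraMap R S b • v := funext fun e => by
    rw [Function.comp_apply, hw, Algebra.smul_def, Pi.smul_apply, smul_eq_mul]
  have h0 : ∀ a, algebraMap R S ((A *ᵥ w) a) = 0 := fun a => by
    have := congrFun (map_algebraMap_mulVec S A w) a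
    rw [hw', Matrix.mulVec_smul, hv, smul_zero] at this
    exact this.symm
  choose t ht using fun a => (IsLocalization.map_eq_zero_iff M S _).1 (h0 a)
  obtain ⟨u, hu⟩ := h (((∏ a, t a : M) : R) • w) (by
    classical
    rw [Matrix.mulVec_smul]
    funext a
    rw [Pi.smul_apply, smul_eq_mul, ← Finset.prod_erase_mul _ _ (Finset.mem_univ a),
      Submonoid.coe_mul, mul_assoc, ht, mul_zero, Pi.zero_apply])
  obtain ⟨s, hs⟩ := IsLocalization.map_units S ((∏ a, t a) * b)
  refine ⟨(↑s⁻¹ : S) • (algebraMap R S ∘ u), ?_⟩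
  have h1 : algebraMap R S ∘ (((∏ a, t a : M) : R) • w) = (s : S) • v := by
    rw [hs, Submonoid.coe_mul, map_mul, mul_smul, ← hw']
    funext e
    simp
  rw [Matrix.mulVec_smul, map_algebraMap_mulVec, hu, h1, smul_smul, Units.inv_mul, one_smul]

/-- Localization is compatible with the ideal generated by the entries of a row. -/
lemma mem_map_iff_of_isLocalization (M : Submonoid R) (S : Type v) [CommRing S] [Algebra R S]
    [IsLocalization M S] {I : Ideal R} [Unique l] {A : Matrix l m R}
    (h : ∀ x, x ∈ I ↔ ∃ w, (A *ᵥ w) default = x) (x : S) :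
    x ∈ I.map (algebraMap R S) ↔ ∃ w, (A.map (algebraMap R S) *ᵥ w) default = x := by
  constructor
  · intro hx
    obtain ⟨⟨⟨a, ha⟩, s⟩, hs⟩ := (IsLocalization.mem_map_algebraMap_iff M S).1 hx
    obtain ⟨w, rfl⟩ := (h a).1 ha
    obtain ⟨s', hs'⟩ := IsLocalization.map_units S s
    refine ⟨(↑s'⁻¹ : S) • (algebraMap R S ∘ w), ?_⟩
    rw [Matrix.mulVec_smul, map_algebraMap_mulVec, Pi.smul_apply, smul_eq_mul,
      Units.inv_mul_eq_iff_eq_mul, hs', mul_comm, hs]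
    rfl
  · classical
    rintro ⟨w, rfl⟩
    rw [Matrix.mulVec, dotProduct]
    refine Ideal.sum_mem _ fun e _ => Ideal.mul_mem_right _ _ (Ideal.mem_map_of_mem _ ?_)
    exact (h _).2 ⟨Pi.single e 1, by rw [Matrix.mulVec_single_one]; rfl⟩

end LocalizationMatrix

namespace BasedComplex

variable {R : Type u} [CommRing R] {C : BasedComplex R} {I : Ideal R}

/-- The base change of a complex along an algebra map. -/
def baseChange (C : BasedComplex R) (S : Type v) [CommRing S] [Algebra R S] : BasedComplex S where
  ι := C.ι
  d i := (C.d i).map (algebraMap R S)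
  d_mul_d i := by rw [← Matrix.map_mul, C.d_mul_d, Matrix.map_zero _ (map_zero _)]

/-- Localization preserves resolutions. -/
lemma IsResolution.localization (hC : C.IsResolution I) (M : Submonoid R) (S : Type v) [CommRing S]
    [Algebra R S] [IsLocalization M S] :
    (C.baseChange S).IsResolution (I.map (algebraMap R S)) where
  exact i _ hv := exists_map_mulVec_eq_of_isLocalization M S (hC.exact i) hv
  mem_iff x := mem_map_iff_of_isLocalization M S hC.mem_iff x

end BasedComplex

section Quotient

variable {R : Type u} [CommRing R] {I : Ideal R}

/-- The localization of `R ⧸ I` at the image of a prime ideal is a quotient of the localization of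
`R` by the extension of `I`. -/
lemma localRingHom_quotient_surjective_and_ker (𝔪 : Ideal R) [𝔪.IsPrime] (P : Ideal (R ⧸ I))
    [P.IsPrime] (hP : 𝔪 = P.comap (Ideal.Quotient.mk I)) :
    Function.Surjective (Localization.localRingHom 𝔪 P (Ideal.Quotient.mk I) hP) ∧
      RingHom.ker (Localization.localRingHom 𝔪 P (Ideal.Quotient.mk I) hP) =
        I.map (algebraMap R (Localization.AtPrime 𝔪)) := by
  have hmem : ∀ s, Ideal.Quotient.mk I s ∈ P ↔ s ∈ 𝔪 := fun s => by rw [hP]; rfl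
  constructor
  · intro y
    obtain ⟨r, ⟨s, hs⟩, rfl⟩ := IsLocalization.exists_mk'_eq P.primeCompl y
    obtain ⟨r, rfl⟩ := Ideal.Quotient.mk_surjective r
    obtain ⟨s, rfl⟩ := Ideal.Quotient.mk_surjective s
    exact ⟨IsLocalization.mk' _ r (⟨s, fun h => hs ((hmem s).2 h)⟩ : 𝔪.primeCompl),
      Localization.localRingHom_mk' _ _ _ _ _ _⟩
  · refine le_antisymm (fun x hx => ?_) (Ideal.map_le_iff_le_comap.2 fun x hx => ?_)
    · obtain ⟨r, s, rfl⟩ := IsLocalization.exists_mk'_eq 𝔪.primeCompl x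
      rw [RingHom.mem_ker, Localization.localRingHom_mk', IsLocalization.mk'_eq_zero_iff] at hx
      obtain ⟨⟨t, ht⟩, htr⟩ := hx
      obtain ⟨t, rfl⟩ := Ideal.Quotient.mk_surjective t
      rw [← map_mul, Ideal.Quotient.eq_zero_iff_mem] at htr
      refine (IsLocalization.mk'_mem_map_algebraMap_iff 𝔪.primeCompl _ I r s).2
        ⟨t, fun h => ht ((hmem t).2 h), htr⟩
    · rw [Ideal.mem_comap, RingHom.mem_ker, Localization.localRingHom_to_map,
        Ideal.Quotient.eq_zero_iff_mem.2 hx, map_zero]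

end Quotient

/-! ### Standard graded algebras -/

namespace IsStandardGraded

variable {k : Type v} {R : Type u} [Field k] [CommRing R] [Algebra k R] {𝒜 : ℕ → Submodule k R}
  [GradedAlgebra 𝒜] {I : Ideal R}

lemma isUnit_of_mem_zero (h : IsStandardGraded 𝒜) {x : R} (hx : x ∈ 𝒜 0) (hx0 : x ≠ 0) :
    IsUnit x := by
  rw [h.degree_zero] at hx
  obtain ⟨c, rfl⟩ := Submodule.mem_one.1 hx
  exact (IsUnit.mk0 c fun hc => hx0 (by rw [hc, map_zero])).map (algebraMap k R)

lemma isUnit_proj_zero (h : IsStandardGraded 𝒜) {x : R}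
    (hx : x ∉ (HomogeneousIdeal.irrelevant 𝒜).toIdeal) : IsUnit (GradedRing.proj 𝒜 0 x) :=
  h.isUnit_of_mem_zero (SetLike.coe_mem _) fun h0 =>
    hx ((HomogeneousIdeal.mem_irrelevant_iff 𝒜 x).2 h0)

lemma le_irrelevant (h : IsStandardGraded 𝒜) (hI : I.IsHomogeneous 𝒜) (htop : I ≠ ⊤) :
    I ≤ (HomogeneousIdeal.irrelevant 𝒜).toIdeal := fun x hx => by
  by_contra hx'
  exact htop (I.eq_top_of_isUnit_mem (hI 0 hx) (h.isUnit_proj_zero hx'))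

lemma isMaximal_irrelevant [Nontrivial R] (h : IsStandardGraded 𝒜) :
    (HomogeneousIdeal.irrelevant 𝒜).toIdeal.IsMaximal := by
  refine Ideal.isMaximal_iff.2 ⟨fun h1 => ?_, fun J x hJ hx hxJ => ?_⟩
  · have := (HomogeneousIdeal.mem_irrelevant_iff 𝒜 1).1 h1
    rw [GradedRing.proj_apply, DirectSum.decompose_one] at this
    exact one_ne_zero this
  · have hsub : x - GradedRing.proj 𝒜 0 x ∈ (HomogeneousIdeal.irrelevant 𝒜).toIdeal := by
      refine (HomogeneousIdeal.mem_irrelevant_iff 𝒜 _).2 ?_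
      rw [map_sub, sub_eq_zero]
      exact (DirectSum.decompose_of_mem_same 𝒜 (SetLike.coe_mem _)).symm
    have hmem : GradedRing.proj 𝒜 0 x ∈ J := by
      have := J.sub_mem hxJ (hJ hsub)
      rwa [sub_sub_cancel] at this
    exact (Ideal.eq_top_iff_one J).1 (J.eq_top_of_isUnit_mem hmem (h.isUnit_proj_zero hx))

/-- Elements outside the irrelevant ideal are not zero divisors modulo a homogeneous ideal: their
component of degree `0` is a unit. -/
lemma mem_of_mul_mem (h : IsStandardGraded 𝒜) (hI : I.IsHomogeneous 𝒜) {s f : R}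
    (hs : s ∉ (HomogeneousIdeal.irrelevant 𝒜).toIdeal) (hsf : s * f ∈ I) : f ∈ I := by
  classical
  have hcomp : ∀ n, (DirectSum.decompose 𝒜 f n : R) ∈ I := by
    intro n
    induction n using Nat.strong_induction_on with
    | _ n ih =>
      have h1 : (DirectSum.decompose 𝒜 (s * f) n : R) ∈ I := hI n hsf
      rw [DirectSum.decompose_mul, DirectSum.coe_mul_apply] at h1
      have h2 : ∑ ij ∈ ((DirectSum.decompose 𝒜 s).support ×ˢ
          (DirectSum.decompose 𝒜 f).support).filter (fun ij => ij.1 + ij.2 = n),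
          (DirectSum.decompose 𝒜 s ij.1 : R) * DirectSum.decompose 𝒜 f ij.2 -
          DirectSum.decompose 𝒜 s 0 * DirectSum.decompose 𝒜 f n ∈ I := by
        by_cases hmem : ((0, n) : ℕ × ℕ) ∈ ((DirectSum.decompose 𝒜 s).support ×ˢ
          (DirectSum.decompose 𝒜 f).support).filter (fun ij => ij.1 + ij.2 = n)
        · rw [← Finset.add_sum_erase _ _ hmem, add_sub_cancel_left]
          refine I.sum_mem fun ij hij => I.mul_mem_left _ (ih _ ?_)
          obtain ⟨i, j⟩ := ij
          simp only [Finset.mem_erase, ne_eq, Prod.mk.injEq, Finset.mem_filter] at hij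
          dsimp only
          omega
        · have h0 : (DirectSum.decompose 𝒜 s 0 : R) * DirectSum.decompose 𝒜 f n = 0 := by
            simp only [Finset.mem_filter, Finset.mem_product, DFinsupp.mem_support_iff, zero_add,
              and_true, not_and_or, not_not] at hmem
            rcases hmem with h0 | h0 <;> rw [h0] <;> simp
          rw [h0, sub_zero]
          refine I.sum_mem fun ij hij => I.mul_mem_left _ (ih _ ?_)
          obtain ⟨i, j⟩ := ij
          have hne : i ≠ 0 := by
            rintro rfl
            have hj := (Finset.mem_filter.1 hij).2
            simp only [zero_add] at hj
            exact hmem (hj ▸ hij)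
          have := (Finset.mem_filter.1 hij).2
          dsimp only at this ⊢
          omega
      have h3 := I.sub_mem h1 h2
      rw [sub_sub_cancel] at h3
      exact (Ideal.unit_mul_mem_iff_mem I (h.isUnit_proj_zero hs)).1 h3
  rw [← DirectSum.sum_support_decompose 𝒜 f]
  exact I.sum_mem fun n _ => hcomp n

/-- A homogeneous ideal is the contraction of its localization at the irrelevant ideal. -/
lemma comap_map_localization (h : IsStandardGraded 𝒜)
    [hprime : (HomogeneousIdeal.irrelevant 𝒜).toIdeal.IsPrime] (hI : I.IsHomogeneous 𝒜) :
    (I.map (algebraMap R (Localization.AtPrime (HomogeneousIdeal.irrelevant 𝒜).toIdeal))).comap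
      (algebraMap R (Localization.AtPrime (HomogeneousIdeal.irrelevant 𝒜).toIdeal)) = I := by
  refine le_antisymm (fun f hf => ?_) Ideal.le_comap_map
  obtain ⟨s, hs, hsf⟩ := (IsLocalization.algebraMap_mem_map_algebraMap_iff
    (HomogeneousIdeal.irrelevant 𝒜).toIdeal.primeCompl _ I f).1 hf
  exact h.mem_of_mul_mem hI hs hsf

end IsStandardGraded

theorem proposition2p2 (p c : ℕ) (hp : p.Prime) (hc : 2 ≤ c) :
    -- an ideal in a regular local ring of characteristic `p`
    (∀ (R : Type u) [CommRing R] [IsRegularLocalRing R] [CharP R p] (I : Ideal R),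
      I.height = c → IsGorensteinLocalRing (R ⧸ I) →
      ∀ F : FreeResolution I, F.IsMinimal (IsLocalRing.maximalIdeal R) →
        F.rank c = 1 ∧ (∀ i, c < i → F.rank i = 0) ∧
        ∀ (α : F.FrobeniusComparison p) (Δ : R), α.map c = Δ • 1 →
          Ideal.span {Δ} * I ≤ IsLocalRing.maximalIdeal R * frobeniusPower p I) ∧
    -- a homogeneous ideal in a standard graded regular ring over a field of characteristic `p`
    (∀ (k : Type v) (R : Type u) [Field k] [CharP k p] [CommRing R] [Algebra k R]
      [IsRegularRing R] (𝒜 : ℕ → Submodule k R) [GradedAlgebra 𝒜] (I : Ideal R),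
      IsStandardGraded 𝒜 → I.IsHomogeneous 𝒜 →
      I.height = c → IsGorensteinRing (R ⧸ I) →
      ∀ F : FreeResolution I, F.IsGraded 𝒜 →
        F.IsMinimal (HomogeneousIdeal.irrelevant 𝒜).toIdeal →
        F.rank c = 1 ∧ (∀ i, c < i → F.rank i = 0) ∧
        ∀ (α : F.FrobeniusComparison p) (Δ : R), α.map c = Δ • 1 →
          Ideal.span {Δ} * I ≤ (HomogeneousIdeal.irrelevant 𝒜).toIdeal * frobeniusPower p I) := by
  obtain ⟨l, rfl⟩ : ∃ l, c = l + 1 := ⟨c - 1, by omega⟩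
  refine ⟨fun R _ _ _ I hI hA F hF => ?_, fun k R _ _ _ _ _ 𝒜 _ I h𝒜 hhom hI hA F hgr hF => ?_⟩
  · obtain ⟨h1, h2, h3⟩ := F.isResolution_toBasedComplex.gorenstein hI
      (π := Ideal.Quotient.mk I) Ideal.Quotient.mk_surjective Ideal.mk_ker hA hF
    refine ⟨(Fintype.card_fin _).symm.trans h1, fun i hi => ?_, fun α Δ hΔ =>
      α.span_mul_le hp hF (by omega) (h3 l rfl) hΔ⟩
    exact (Fintype.card_fin _).symm.trans (Fintype.card_eq_zero_iff.2 (h2 i hi))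
  · have htop : I ≠ ⊤ := by
      rintro rfl
      rw [Ideal.height_top] at hI
      exact ENat.natCast_ne_top _ hI.symm
    have : Nontrivial R := nontrivial_of_ne (0 : R) 1 fun h01 =>
      htop ((Ideal.eq_top_iff_one I).2 (h01 ▸ I.zero_mem))
    have : CharP R p := charP_of_injective_algebraMap (algebraMap k R).injective p
    have hmax := h𝒜.isMaximal_irrelevant
    set 𝔪 := (HomogeneousIdeal.irrelevant 𝒜).toIdeal with h𝔪
    have hIm : I ≤ 𝔪 := h𝒜.le_irrelevant hhom htop
    have hprime : 𝔪.IsPrime := hmax.isPrime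
    have hcomap : (𝔪.map (Ideal.Quotient.mk I)).comap (Ideal.Quotient.mk I) = 𝔪 := by
      rw [Ideal.comap_map_of_surjective _ Ideal.Quotient.mk_surjective, sup_eq_left,
        ← RingHom.ker_eq_comap_bot, Ideal.mk_ker]
      exact hIm
    have hPmax : (𝔪.map (Ideal.Quotient.mk I)).IsMaximal :=
      (Ideal.map_eq_top_or_isMaximal_of_surjective _ Ideal.Quotient.mk_surjective hmax).resolve_left
        fun h => hmax.ne_top (by rw [← hcomap, h, Ideal.comap_top])
    obtain ⟨hsurj, hker⟩ := localRingHom_quotient_surjective_and_ker 𝔪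
      (𝔪.map (Ideal.Quotient.mk I)) hcomap.symm
    have hloc := h𝒜.comap_map_localization hhom
    have hht : (I.map (algebraMap R (Localization.AtPrime 𝔪))).height = (l + 1 : ℕ) := by
      rw [← IsLocalization.height_under 𝔪.primeCompl, ← hI]
      exact congrArg Ideal.height hloc
    have hres := F.isResolution_toBasedComplex.localization 𝔪.primeCompl
      (Localization.AtPrime 𝔪)
    obtain ⟨h1, h2, h3⟩ := hres.gorenstein hht hsurj hker
      (hA.isGorensteinLocalRing_localization _) fun i a b =>
        (IsLocalization.AtPrime.to_map_mem_maximal_iff (Localization.AtPrime 𝔪) 𝔪 _).2 (hF i a b)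
    refine ⟨(Fintype.card_fin _).symm.trans h1, fun i hi => ?_, fun α Δ hΔ =>
      α.span_mul_le hp hF (by omega) ?_ hΔ⟩
    · exact (Fintype.card_fin _).symm.trans (Fintype.card_eq_zero_iff.2 (h2 i hi))
    · -- both ideals are homogeneous and have the same localization at the irrelevant ideal
      have hhom' : (Ideal.span {x : R | ∃ a b, F.d l a b = x}).IsHomogeneous 𝒜 := by
        refine Ideal.homogeneous_span 𝒜 _ ?_
        rintro _ ⟨a, b, rfl⟩
        obtain ⟨deg, hdeg⟩ := hgr
        rcases hdeg l a b with h0 | ⟨n, -, hn⟩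
        · rw [h0]
          exact ⟨0, Submodule.zero_mem _⟩
        · exact ⟨n, hn⟩
      have hmap : (Ideal.span {x : R | ∃ a b, F.d l a b = x}).map
          (algebraMap R (Localization.AtPrime 𝔪)) =
          I.map (algebraMap R (Localization.AtPrime 𝔪)) := by
        rw [← h3 l rfl, Ideal.map_span]
        congr 1
        ext x
        constructor
        · rintro ⟨_, ⟨a, b, rfl⟩, rfl⟩
          exact ⟨a, b, rfl⟩
        · rintro ⟨a, b, rfl⟩
          exact ⟨_, ⟨a, b, rfl⟩, rfl⟩
      rw [← h𝒜.comap_map_localization hhom', hmap, hloc]
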